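/- **Setting.** A space of graphs $\mathcal G$ is a family of finite simple graphs, and a node coloring $\mathcal C$ of $\mathcal G$ with values in $\chi\subseteq\mathbb R^N$ assigns a feature $\mathcal C(v)\in\chi$ to every node $v$ of every $G\in\mathcal G$. It satisfies the *degree assumption* if any two nodes (possibly of different graphs in $\mathcal G$) of the same color have the same degree. A *stable WL coloring* (from constant initial colors) is one with $\mathcal C(u)=\mathcal C(v)$ if and only if $u$ and $v$ have the same color $X_t$ after every number $t$ of rounds of the Weisfeiler–Lehman refinement $X_{t+1}(v)=\big(X_t(v),\{\{X_t(w): w\sim v\}\}\big)$, $X_0$ constant. *Persistence diagrams.* For a matrix $M$ of (possibly infinite) distances on a finite set $V$, $\mathrm{VR}_1^\varepsilon(V,M)$ is the $1$-skeleton of its Vietoris–Rips complex at scale $\varepsilon$, and $\mathrm{ph}^i$ denotes the $i$-th persistence diagram over $\mathbb Z/2$, a multiset of points $(b,d)$ with $b<d\le\infty$. *TED.* An *injective edge filtration* for $\mathcal C$ is a positive, bounded, injective real function $ef$ on the set of colored edges $\{\{\mathcal C(u),\mathcal C(v)\}\}$, $uv\in E(G)$, $G\in\mathcal G$. $\mathrm{TED}(G,ef)=(\mathrm{ph}^0,\mathrm{ph}^1)$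 of $\{\mathrm{VR}^\varepsilon_1(V(G),M)\}_{\varepsilon\ge 0}$, where $M$ is $0$ on the diagonal, $ef(\{\{\mathcal C(u),\mathcal C(v)\}\})$ if $uv\in E(G)$, and $\infty$ otherwise. *LGVR.* Its weights $\theta$ consist of a multi-layer perceptron $m:\mathbb R^N\to\mathbb R^N$ (ReLU, at least one hidden layer), a scalar $\eta$, a dimension $d$, and two node-level graph isomorphism networks $P_1$ (features $\mathbb R^{2N}\to\mathbb R^d$) and $P_2$ (features $\mathbb R^d\to\mathbb R$) with at least one layer each, a layer being $h_v\mapsto \mathrm{MLP}\big((1+\epsilon)h_v+\sum_{w\sim v}h_w\big)$. Put $x'=x+\eta\, m(x)$ and $\phi(\{\{x,y\}\})=(x'+y',|x'-y'|)\in\mathbb R^{2N}$ (componentwise absolute value). Given $(G,\mathcal C)$: color each edge $uv$ of $G$ (a node of the line graph $L_G$) by $\phi(\{\{\mathcal C(u),\mathcal C(v)\}\})$ and apply $P_1$ on $L_G$; extend the resulting features by $0$ to the line graph $L_{K_G}$ of the complete graph on $V(G)$; apply $P_2$ on $L_{K_G}$ followed by the logistic sigmoid. The resulting values, with zero diagonal,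 form the matrix $A_G^{\mathcal C}$, and $\mathrm{LGVR}_\theta(G,\mathcal C)=(\mathrm{ph}^0,\mathrm{ph}^1)$ of $\{\mathrm{VR}_1^\varepsilon(V(G),A_G^{\mathcal C})\}_{\varepsilon\in[0,1/2]}$. **Theorem.** Let $\chi\subseteq\mathbb R^N$ be countable. Then there are weights $\theta$ (depending only on $N$ and $\chi$) such that for every space of graphs $\mathcal G$ and every node coloring $\mathcal C$ of $\mathcal G$ with values in $\chi$ the following holds. 1. Suppose that $\mathcal C$ satisfies the degree assumption. If $G,H\in\mathcal G$ have no isolated nodes and $\{\{\mathcal C(v): v\in V(G)\}\}\ne\{\{\mathcal C(v): v\in V(H)\}\}$, then $\mathrm{LGVR}_\theta(G,\mathcal C)\ne\mathrm{LGVR}_\theta(H,\mathcal C)$. 2. Suppose that $\mathcal C$ is a stable WL coloring. If $G,H\in\mathcal G$ satisfy $\{\{\mathcal C(v): v\in V(G)\}\}\ne\{\{\mathcal C(v): v\in V(H)\}\}$ (they are distinguished by WL), then $\mathrm{LGVR}_\theta(G,\mathcal C)\ne\mathrm{LGVR}_\theta(H,\mathcal C)$. Moreover, if $\mathcal G$ contains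 every finite simple graph up to isomorphism, there are $G,H\in\mathcal G$ with $\{\{\mathcal C(v): v\in V(G)\}\}=\{\{\mathcal C(v): v\in V(H)\}\}$ (not distinguished by WL) and $\mathrm{LGVR}_\theta(G,\mathcal C)\ne\mathrm{LGVR}_\theta(H,\mathcal C)$. 3. LGVR shares these separation properties with TED: in 1 and in both parts of 2 (with the same pair $G,H$) also $\mathrm{TED}(G,ef)\ne\mathrm{TED}(H,ef)$ for every injective edge filtration $ef$ for $\mathcal C$. -/

import Mathlib

open scoped NNReal

universe u v

namespace TopEdge

noncomputable section

/-! ### Graph spaces, node colorings, colored edges -/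

/-- A space of finite simple graphs: a family of finite simple graphs indexed by an arbitrary type.
The same graph may occur several times (with different node colorings). -/
structure GraphSpace where
  Idx : Type u
  V : Idx → Type v
  [finite : ∀ G, Fintype (V G)]
  graph : ∀ G, SimpleGraph (V G)

attribute [instance] GraphSpace.finite

/-- The node features: vectors in `ℝ ^ N`. -/
abbrev Feature (N : ℕ) : Type := Fin N → ℝ

/-- A node coloring assigns a node feature to every node of every graph of the space. -/
abbrev NodeColoring (𝒢 : GraphSpace.{u, v}) (N : ℕ) : Type (max u v) :=
  ∀ G : 𝒢.Idx, 𝒢.V G → Feature N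

/-- The multiset of node colors of a graph. -/
def colorMultiset {𝒢 : GraphSpace.{u, v}} {N : ℕ} (C : NodeColoring 𝒢 N) (G : 𝒢.Idx) :
    Multiset (Feature N) :=
  Finset.univ.val.map (C G)

/-- No vertex is isolated. -/
def NoIsolated {V : Type v} (g : SimpleGraph V) : Prop :=
  ∀ w, ∃ w', g.Adj w w'

open Classical in
/-- The degree assumption: nodes of the same color (possibly in different graphs of the space) have
the same degree. -/
def DegreeAssumption {𝒢 : GraphSpace.{u, v}} {N : ℕ} (C : NodeColoring 𝒢 N) : Prop :=
  ∀ (G H : 𝒢.Idx) (x : 𝒢.V G) (y : 𝒢.V H),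
    C G x = C H y → (𝒢.graph G).degree x = (𝒢.graph H).degree y

/-- Every finite simple graph is isomorphic to a member of the space. -/
def ContainsAllFiniteGraphs (𝒢 : GraphSpace.{u, v}) : Prop :=
  ∀ (n : ℕ) (g : SimpleGraph (Fin n)), ∃ G : 𝒢.Idx, Nonempty (g ≃g 𝒢.graph G)

/-! ### The Weisfeiler-Lehman test -/

/-- The colors after `t` rounds of the Weisfeiler-Lehman refinement. The new color of a node is the
pair (old color, multiset of old colors of the neighbors), i.e. the hash is the identity. -/
def WLColor : ℕ → Type
  | 0 => Unit
  | t + 1 => WLColor t × Multiset (WLColor t)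

open Classical in
/-- The Weisfeiler-Lehman color of a node after `t` rounds, from the constant initial coloring. -/
def wlColor {V : Type v} [Fintype V] (g : SimpleGraph V) : (t : ℕ) → V → WLColor t
  | 0 => fun _ => ()
  | t + 1 => fun x => (wlColor g t x, (g.neighborFinset x).val.map (wlColor g t))

/-- `C` is a stable Weisfeiler-Lehman coloring (all initial colors being the same): two nodes,
possibly in different graphs, get the same feature iff no round of the refinement tells
them apart. -/
def IsStableWL {𝒢 : GraphSpace.{u, v}} {N : ℕ} (C : NodeColoring 𝒢 N) : Prop :=
  ∀ (G H : 𝒢.Idx) (x : 𝒢.V G) (y : 𝒢.V H),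
    C G x = C H y ↔ ∀ t, wlColor (𝒢.graph G) t x = wlColor (𝒢.graph H) t y

/-! ### Simplicial chains over `ℤ / 2` and persistence diagrams -/

section Persistence

variable {V : Type v}

/-- The space containing the chains of all degrees: formal sums of finite vertex sets. -/
abbrev Chain (V : Type v) : Type v := Finset V →₀ ZMod 2

/-- The `n`-chains of a simplicial complex: the span of its simplices with `n + 1` vertices. -/
def chains (n : ℕ) (K : PreAbstractSimplicialComplex V) : Submodule (ZMod 2) (Chain V) :=
  Finsupp.supported (ZMod 2) (ZMod 2) {σ : Finset V | σ ∈ K ∧ σ.card = n + 1}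

open Classical in
/-- The simplicial boundary: a simplex goes to the sum of its facets, a vertex goes to `0`. -/
def boundary (V : Type v) : Chain V →ₗ[ZMod 2] Chain V :=
  Finsupp.linearCombination (ZMod 2) fun σ : Finset V =>
    ∑ x ∈ σ, if (σ.erase x).Nonempty then Finsupp.single (σ.erase x) (1 : ZMod 2) else 0

/-- The `n`-cycles of a simplicial complex. -/
def cycles (n : ℕ) (K : PreAbstractSimplicialComplex V) : Submodule (ZMod 2) (Chain V) :=
  chains n K ⊓ LinearMap.ker (boundary V)

/-- The `n`-boundaries of a simplicial complex. -/
def boundaries (n : ℕ) (K : PreAbstractSimplicialComplex V) : Submodule (ZMod 2) (Chain V) :=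
  (chains (n + 1) K).map (boundary V)

/-- The dimension of the quotient `A / B` of a subspace `A` by a subspace `B ≤ A`. -/
def quotientDim {F E : Type*} [Field F] [AddCommGroup E] [Module F E] (A B : Submodule F E) : ℕ :=
  Module.finrank F (↥A ⧸ B.submoduleOf A)

variable {T : Type*} [LinearOrder T]

/-- The chains that are dead at time `d`: the boundaries at time `d`; everything is
dead at time `∞`. -/
def deadBy (n : ℕ) (K : T → PreAbstractSimplicialComplex V) :
    WithTop T → Submodule (ZMod 2) (Chain V)
  | ⊤ => ⊤
  | (t : T) => boundaries n (K t)

/-- The `n`-th persistence diagram of a filtration, as a multiset of points `(b, d)` (birth, death)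
with `b < d ≤ ∞`, given by its multiplicity function. The multiplicity of `(b, d)` is the dimension
of the space of `n`-cycles that exist at time `b` and are dead at time `d`, modulo those that exist
before time `b` and those that are dead before time `d`. -/
def persistenceDiagram (n : ℕ) (K : T → PreAbstractSimplicialComplex V) :
    T → WithTop T → ℕ := fun b d =>
  open Classical in
  if (b : WithTop T) < d then
    let born : Submodule (ZMod 2) (Chain V) := cycles n (K b)
    let bornBefore : Submodule (ZMod 2) (Chain V) := ⨆ (s : T) (_ : s < b), cycles n (K s)
    let dead : Submodule (ZMod 2) (Chain V) := deadBy n K d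
    let deadBefore : Submodule (ZMod 2) (Chain V) := ⨆ (s : WithTop T) (_ : s < d), deadBy n K s
    quotientDim (born ⊓ dead) ((bornBefore ⊓ dead) ⊔ (born ⊓ deadBefore))
  else 0

/-- The `k`-skeleton of the Vietoris-Rips complex of scale `ε` of a finite point cloud with a matrix
of (possibly infinite) distances: the nonempty sets of at most `k + 1` points, any two of which are
at distance at most `ε`. -/
def vietorisRips (k : ℕ) (M : V → V → EReal) (ε : ℝ) : PreAbstractSimplicialComplex V where
  faces := {σ | σ.Nonempty ∧ σ.card ≤ k + 1 ∧ ∀ x ∈ σ, ∀ y ∈ σ, M x y ≤ (ε : EReal)}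
  isRelLowerSet_faces := by
    rintro σ ⟨hne, hcard, hM⟩
    refine ⟨hne, fun τ hτ hτne => ⟨hτne, (Finset.card_le_card hτ).trans hcard, ?_⟩⟩
    exact fun x hx y hy => hM x (hτ hx) y (hτ hy)

end Persistence

/-! ### Topological edge diagrams -/

/-- The set of colored edges `{{C x, C y}}`, over all edges of all graphs of the space. -/
def coloredEdges {𝒢 : GraphSpace.{u, v}} {N : ℕ} (C : NodeColoring 𝒢 N) :
    Set (Sym2 (Feature N)) :=
  {c | ∃ (G : 𝒢.Idx) (x y : 𝒢.V G), (𝒢.graph G).Adj x y ∧ c = s(C G x, C G y)}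

/-- An injective edge filtration: a positive, bounded and injective real function on the colored
edges (its values elsewhere play no role). -/
structure IsInjectiveEdgeFiltration {𝒢 : GraphSpace.{u, v}} {N : ℕ} (C : NodeColoring 𝒢 N)
    (ef : Sym2 (Feature N) → ℝ) : Prop where
  pos : ∀ c ∈ coloredEdges C, 0 < ef c
  bdd : BddAbove (ef '' coloredEdges C)
  inj : Set.InjOn ef (coloredEdges C)

open Classical in
/-- The distance matrix of an edge filtration: the value of the filtration on the edges, `∞` between
distinct nonadjacent nodes, and `0` on the diagonal. -/
def tedMatrix {𝒢 : GraphSpace.{u, v}} {N : ℕ} (C : NodeColoring 𝒢 N)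
    (ef : Sym2 (Feature N) → ℝ) (G : 𝒢.Idx) (x y : 𝒢.V G) : EReal :=
  if x = y then 0
  else if (𝒢.graph G).Adj x y then ((ef s(C G x, C G y) : ℝ) : EReal)
  else ⊤

/-- The topological edge diagram of a graph: the `0`-th and the `1`-st persistence diagram of the
`1`-skeleton of its Vietoris-Rips filtration, over all scales `ε ≥ 0`. -/
def TED {𝒢 : GraphSpace.{u, v}} {N : ℕ} (C : NodeColoring 𝒢 N)
    (ef : Sym2 (Feature N) → ℝ) (G : 𝒢.Idx) :
    (ℝ≥0 → WithTop ℝ≥0 → ℕ) × (ℝ≥0 → WithTop ℝ≥0 → ℕ) :=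
  (persistenceDiagram 0 fun ε : ℝ≥0 => vietorisRips 1 (tedMatrix C ef G) (ε : ℝ),
   persistenceDiagram 1 fun ε : ℝ≥0 => vietorisRips 1 (tedMatrix C ef G) (ε : ℝ))

/-! ### Multi-layer perceptrons and graph isomorphism networks -/

/-- The affine map with given weights and biases. -/
def affine {m n : ℕ} (W : Matrix (Fin n) (Fin m) ℝ) (b : Fin n → ℝ) (x : Fin m → ℝ) : Fin n → ℝ :=
  W.mulVec x + b

/-- The componentwise rectified linear unit. -/
def relu {n : ℕ} (x : Fin n → ℝ) : Fin n → ℝ := fun i => max (x i) 0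

/-- The weights of a multi-layer perceptron `ℝ ^ m → ℝ ^ n` with at least one hidden layer. -/
inductive MLP : ℕ → ℕ → Type
  | shallow {m k n : ℕ} (W₁ : Matrix (Fin k) (Fin m) ℝ) (b₁ : Fin k → ℝ)
      (W₂ : Matrix (Fin n) (Fin k) ℝ) (b₂ : Fin n → ℝ) : MLP m n
  | deeper {m k n : ℕ} (W : Matrix (Fin k) (Fin m) ℝ) (b : Fin k → ℝ) (rest : MLP k n) : MLP m n

/-- The map computed by a multi-layer perceptron with ReLU activations after the hidden layers. -/
def MLP.eval : {m n : ℕ} → MLP m n → (Fin m → ℝ) → (Fin n → ℝ)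
  | _, _, .shallow W₁ b₁ W₂ b₂, x => affine W₂ b₂ (relu (affine W₁ b₁ x))
  | _, _, .deeper W b rest, x => rest.eval (relu (affine W b x))

open Classical in
/-- One layer of a graph isomorphism network:
`h x ↦ MLP ((1 + ε) h x + ∑ h y)`, the sum being over the neighbors `y` of `x`. -/
def ginLayer {m n : ℕ} (ε : ℝ) (p : MLP m n) {V : Type v} [Fintype V] (g : SimpleGraph V)
    (h : V → Fin m → ℝ) : V → Fin n → ℝ :=
  fun x => p.eval ((1 + ε) • h x + ∑ y ∈ g.neighborFinset x, h y)

/-- The weights of a node-level graph isomorphism network with at least one layer, taking node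
features in `ℝ ^ m` to node features in `ℝ ^ n`. -/
inductive GIN : ℕ → ℕ → Type
  | last {m n : ℕ} (ε : ℝ) (p : MLP m n) : GIN m n
  | layer {m k n : ℕ} (ε : ℝ) (p : MLP m k) (rest : GIN k n) : GIN m n

/-- The node features computed by a graph isomorphism network on a graph with node features. -/
def GIN.eval {V : Type v} [Fintype V] (g : SimpleGraph V) :
    {m n : ℕ} → GIN m n → (V → Fin m → ℝ) → V → Fin n → ℝ
  | _, _, .last ε p, h => ginLayer ε p g h
  | _, _, .layer ε p rest, h => rest.eval g (ginLayer ε p g h)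

/-! ### Line graph Vietoris-Rips persistence diagrams -/

/-- The weights of an LGVR network on node features in `ℝ ^ N`: the perceptron and the scalar of the
edge coloring `φ`, a graph isomorphism network on the line graph, and a graph isomorphism network
with scalar output on the line graph of the complete graph. -/
structure LGVRWeights (N : ℕ) where
  mlp : MLP N N
  η : ℝ
  d : ℕ
  P₁ : GIN (N + N) d
  P₂ : GIN d 1

/-- The map `x ↦ x + η • mlp x`. -/
def shifted {N : ℕ} (θ : LGVRWeights N) (x : Feature N) : Feature N :=
  x + θ.η • θ.mlp.eval x

/-- The edge coloring `φ {{x, y}} = (x' + y', |x' - y'|)` in `ℝ ^ (2 N)`, where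
`x' = x + η • mlp x`, `y' = y + η • mlp y` and the absolute value is componentwise. -/
def phi {N : ℕ} (θ : LGVRWeights N) : Sym2 (Feature N) → (Fin (N + N) → ℝ) :=
  Sym2.lift ⟨fun x y =>
    Fin.append (shifted θ x + shifted θ y) (fun i => |shifted θ x i - shifted θ y i|),
    fun x y => by simp only [add_comm, abs_sub_comm]⟩

section LGVR

variable {N : ℕ} (θ : LGVRWeights N) {V : Type v} [Fintype V] (g : SimpleGraph V)
  (c : V → Feature N)

open Classical in
/-- The features on the nodes of the line graph (the edges `{x, y}`): `P₁` applied to the coloring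
`φ {{c x, c y}}`. -/
def lineFeatures : g.edgeSet → Fin θ.d → ℝ :=
  θ.P₁.eval g.lineGraph fun e => phi θ ((e : Sym2 V).map c)

open Classical in
/-- The features of the line graph, extended by zero to the line graph of the complete graph. -/
def extendedFeatures : (⊤ : SimpleGraph V).edgeSet → Fin θ.d → ℝ := fun e =>
  if h : (e : Sym2 V) ∈ g.edgeSet then lineFeatures θ g c ⟨e, h⟩ else 0

open Classical in
/-- The value of every edge of the complete graph: `P₂`, made `[0, 1]`-valued by the logistic
sigmoid, applied to the extended features. -/
def edgeValue (e : (⊤ : SimpleGraph V).edgeSet) : ℝ :=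
  Real.sigmoid (θ.P₂.eval (⊤ : SimpleGraph V).lineGraph (extendedFeatures θ g c) e 0)

open Classical in
/-- The edge filtration matrix. -/
def edgeMatrix (x y : V) : ℝ :=
  if h : x = y then 0
  else edgeValue θ g c ⟨s(x, y), (SimpleGraph.mem_edgeSet _).2 ((SimpleGraph.top_adj x y).2 h)⟩

/-- The LGVR persistence diagram of a colored graph: the `0`-th and the `1`-st persistence diagram
of the `1`-skeleton of the Vietoris-Rips filtration of the edge filtration matrix, over the scales
`ε ∈ [0, 1 / 2]`. -/
def LGVR :
    (Set.Icc (0 : ℝ) (1 / 2) → WithTop (Set.Icc (0 : ℝ) (1 / 2)) → ℕ) ×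
      (Set.Icc (0 : ℝ) (1 / 2) → WithTop (Set.Icc (0 : ℝ) (1 / 2)) → ℕ) :=
  (persistenceDiagram 0 fun ε : Set.Icc (0 : ℝ) (1 / 2) =>
      vietorisRips 1 (fun x y => ((edgeMatrix θ g c x y : ℝ) : EReal)) (ε : ℝ),
   persistenceDiagram 1 fun ε : Set.Icc (0 : ℝ) (1 / 2) =>
      vietorisRips 1 (fun x y => ((edgeMatrix θ g c x y : ℝ) : EReal)) (ε : ℝ))

end LGVR

end

end TopEdge

/-!
In a filtration of graphs on a fixed node set that starts with the edgeless graph, every entering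
edge either merges two components or creates a cycle. Hence `ph⁰` and `ph¹` together determine the
numbers of components and of edges at every time, and with them the number of nodes and the multiset
of the weights of all pairs of nodes.

If the weight of a pair determines the color of the edge, or that there is none, the diagrams
therefore determine the multiset of colored edges. It counts every node as often as its degree, so
under the degree assumption it determines the multiset of the colors of the nonisolated nodes. The
isolated nodes all have the same stable WL color, and the number of nodes gives their multiplicity.

For a countable set of features, all arguments of each layer of the network form a countable set, on
which generic parameters make the layer injective: `x ↦ w ⬝ᵥ x` is injective on a countable set
unless `w` lies in one of countably many hyperplanes.

WL does not distinguish the hexagon from two disjoint triangles. Since both are `2`-regular, each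
has, at some common time, exactly its own edges in the filtration, and then the numbers of
components differ.
-/

namespace TopEdge

noncomputable section

section LinearAlgebra

variable {F E E' : Type*} [Field F] [AddCommGroup E] [Module F E] [AddCommGroup E']
  [Module F E']

theorem quotientDim_add_finrank {A B : Submodule F E} [FiniteDimensional F A] (h : B ≤ A) :
    quotientDim A B + Module.finrank F B = Module.finrank F A := by
  have := Submodule.finrank_quotient_add_finrank (B.submoduleOf A)
  rwa [(Submodule.submoduleOfEquivOfLe h).finrank_eq] at this

theorem finrank_map_add_finrank_inf_ker (f : E →ₗ[F] E') (A : Submodule F E)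
    [FiniteDimensional F A] :
    Module.finrank F (A.map f) + Module.finrank F ↥(A ⊓ LinearMap.ker f) =
      Module.finrank F A := by
  have hker : LinearMap.ker (f.domRestrict A) = (A ⊓ LinearMap.ker f).submoduleOf A := by
    ext ⟨x, hx⟩
    simp [Submodule.submoduleOf]
  have h := LinearMap.finrank_range_add_finrank_ker (f.domRestrict A)
  rwa [LinearMap.range_domRestrict, hker,
    (Submodule.submoduleOfEquivOfLe inf_le_left).finrank_eq] at h

end LinearAlgebra

section Complex

variable {V : Type v}

theorem chains_mono (n : ℕ) : Monotone (chains (V := V) n) := fun _ _ h =>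
  Finsupp.supported_mono fun _ hσ => ⟨h hσ.1, hσ.2⟩

theorem boundaries_mono (n : ℕ) : Monotone (boundaries (V := V) n) := fun _ _ h =>
  Submodule.map_mono (chains_mono _ h)

theorem cycles_mono (n : ℕ) : Monotone (cycles (V := V) n) := fun _ _ h =>
  inf_le_inf_right _ (chains_mono _ h)

theorem deadBy_coe {T : Type*} (n : ℕ) (K : T → PreAbstractSimplicialComplex V) (t : T) :
    deadBy n K t = boundaries n (K t) :=
  rfl

theorem deadBy_top {T : Type*} (n : ℕ) (K : T → PreAbstractSimplicialComplex V) :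
    deadBy n K ⊤ = ⊤ :=
  rfl

theorem boundaries_one_eq_bot {K : PreAbstractSimplicialComplex V} (h : ∀ σ ∈ K, σ.card ≤ 2) :
    boundaries 1 K = ⊥ := by
  have : {σ | σ ∈ K ∧ σ.card = 1 + 1 + 1} = ∅ :=
    Set.eq_empty_of_forall_notMem fun σ hσ => by have := h σ hσ.1; have := hσ.2; omega
  rw [boundaries, chains, this, Finsupp.supported_empty, Submodule.map_bot]

/-- The span of all vertices: the `0`-chains of every complex that has all points as vertices. -/
def vertexChains (V : Type v) : Submodule (ZMod 2) (Chain V) :=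
  Finsupp.supported (ZMod 2) (ZMod 2) {σ : Finset V | σ.card = 1}

theorem single_mem_vertexChains (x : V) : Finsupp.single {x} 1 ∈ vertexChains V :=
  Finsupp.single_mem_supported _ _ (Finset.card_singleton x)

theorem vertexChains_le_iff {A : Submodule (ZMod 2) (Chain V)} :
    vertexChains V ≤ A ↔ ∀ x, Finsupp.single {x} 1 ∈ A := by
  refine ⟨fun h x => h (single_mem_vertexChains x), fun h => ?_⟩
  rw [vertexChains, Finsupp.supported_eq_span_single, Submodule.span_le]
  rintro _ ⟨σ, hσ, rfl⟩
  obtain ⟨x, rfl⟩ := Finset.card_eq_one.1 hσ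
  exact h x

theorem finrank_supported {α : Type*} [Finite α] (s : Set α) :
    Module.finrank (ZMod 2) (Finsupp.supported (ZMod 2) (ZMod 2) s) = s.ncard := by
  have := Fintype.ofFinite s
  rw [(Finsupp.supportedEquivFinsupp s).finrank_eq, Module.finrank_finsupp_self,
    ← Nat.card_eq_fintype_card, Nat.card_coe_set_eq]

theorem finrank_vertexChains [Finite V] :
    Module.finrank (ZMod 2) (vertexChains V) = Nat.card V := by
  have : {σ : Finset V | σ.card = 1} = Set.range singleton := by
    ext σ
    simp only [Set.mem_ofPred_eq, Finset.card_eq_one, Set.mem_range, eq_comm]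
  rw [vertexChains, finrank_supported, this, ← Nat.card_coe_set_eq,
    Nat.card_range_of_injective Finset.singleton_injective]

theorem boundary_vertex (x : V) : boundary V (Finsupp.single {x} 1) = 0 := by
  simp [boundary]

open Classical in
theorem boundary_edge {x y : V} (h : x ≠ y) :
    boundary V (Finsupp.single {x, y} 1) = Finsupp.single {x} 1 + Finsupp.single {y} 1 := by
  rw [boundary, Finsupp.linearCombination_single, one_smul, Finset.sum_pair h,
    Finset.erase_insert (by simpa using h), Finset.pair_comm,
    Finset.erase_insert (by simpa using h.symm)]
  simp [add_comm]

theorem vertexChains_le_ker_boundary : vertexChains V ≤ LinearMap.ker (boundary V) :=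
  vertexChains_le_iff.2 boundary_vertex

theorem cycles_zero_eq_vertexChains {K : PreAbstractSimplicialComplex V} (h : ∀ x, {x} ∈ K) :
    cycles 0 K = vertexChains V := by
  have : chains 0 K = vertexChains V := by
    rw [chains, vertexChains]
    congr 1
    ext σ
    simp only [zero_add, Set.mem_ofPred_eq, and_iff_right_iff_imp, Finset.card_eq_one]
    rintro ⟨x, rfl⟩
    exact h x
  rw [cycles, this, inf_eq_left.2 vertexChains_le_ker_boundary]

open Classical in
/-- The graph of the `1`-simplices of a complex. -/
def edgeGraph (K : PreAbstractSimplicialComplex V) : SimpleGraph V where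
  Adj x y := x ≠ y ∧ {x, y} ∈ K
  symm := ⟨fun x y h => ⟨h.1.symm, by rw [Finset.pair_comm]; exact h.2⟩⟩

theorem ncard_edgeSet_edgeGraph (K : PreAbstractSimplicialComplex V) :
    (edgeGraph K).edgeSet.ncard = {σ | σ ∈ K ∧ σ.card = 2}.ncard := by
  classical
  refine Set.ncard_congr (fun (e : Sym2 V) _ => e.toFinset) ?_ (fun e f _ _ h => ?_) ?_
  · rintro ⟨x, y⟩ ⟨hne, hmem⟩
    change (s(x, y)).toFinset ∈ K ∧ (s(x, y)).toFinset.card = 2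
    rw [Sym2.toFinset_mk_eq]
    exact ⟨by convert hmem, Finset.card_pair hne⟩
  · ext x
    rw [← Sym2.mem_toFinset, h, Sym2.mem_toFinset]
  · rintro σ ⟨hσ, hcard⟩
    obtain ⟨x, y, hne, rfl⟩ := Finset.card_eq_two.1 hcard
    exact ⟨s(x, y), ⟨hne, by convert hσ⟩, Sym2.toFinset_mk_eq⟩

theorem boundaries_zero_le_iff {K : PreAbstractSimplicialComplex V}
    {A : Submodule (ZMod 2) (Chain V)} :
    boundaries 0 K ≤ A ↔
      ∀ x y, (edgeGraph K).Adj x y → Finsupp.single {x} 1 + Finsupp.single {y} 1 ∈ A := by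
  classical
  rw [boundaries, chains, Finsupp.supported_eq_span_single, Submodule.map_span, Submodule.span_le]
  constructor
  · intro h x y hxy
    rw [← boundary_edge hxy.1]
    exact h ⟨_, ⟨{x, y}, ⟨by convert hxy.2, Finset.card_pair hxy.1⟩, rfl⟩, rfl⟩
  · rintro h _ ⟨_, ⟨σ, hσ, rfl⟩, rfl⟩
    obtain ⟨x, y, hxy, rfl⟩ := Finset.card_eq_two.1 hσ.2
    rw [SetLike.mem_coe, boundary_edge hxy]
    exact h x y ⟨hxy, by convert hσ.1⟩

theorem boundaries_zero_le_vertexChains (K : PreAbstractSimplicialComplex V) :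
    boundaries 0 K ≤ vertexChains V :=
  boundaries_zero_le_iff.2 fun x y _ =>
    add_mem (single_mem_vertexChains x) (single_mem_vertexChains y)

theorem boundaries_zero_eq_bot {K : PreAbstractSimplicialComplex V} (h : edgeGraph K = ⊥) :
    boundaries 0 K = ⊥ := by
  rw [eq_bot_iff, boundaries_zero_le_iff, h]
  exact fun _ _ hxy => hxy.elim

theorem finrank_boundaries_add_finrank_cycles [Finite V] (K : PreAbstractSimplicialComplex V) :
    Module.finrank (ZMod 2) (boundaries 0 K) + Module.finrank (ZMod 2) (cycles 1 K) =
      (edgeGraph K).edgeSet.ncard := by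
  rw [ncard_edgeSet_edgeGraph, ← finrank_supported]
  exact finrank_map_add_finrank_inf_ker (boundary V) (chains 1 K)

/-- The augmentation of the chains onto the span of the connected components, which counts the
vertices in each component. It computes `H₀`. -/
def componentMap (K : PreAbstractSimplicialComplex V) :
    Chain V →ₗ[ZMod 2] ((edgeGraph K).ConnectedComponent →₀ ZMod 2) :=
  Finsupp.linearCombination (ZMod 2) fun σ : Finset V =>
    ∑ x ∈ σ, Finsupp.single ((edgeGraph K).connectedComponentMk x) 1

theorem componentMap_vertex (K : PreAbstractSimplicialComplex V) (x : V) :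
    componentMap K (Finsupp.single {x} 1) =
      Finsupp.single ((edgeGraph K).connectedComponentMk x) 1 := by
  simp [componentMap]

theorem map_componentMap_vertexChains (K : PreAbstractSimplicialComplex V) :
    (vertexChains V).map (componentMap K) = ⊤ := by
  rw [eq_top_iff, ← Finsupp.supported_univ, Finsupp.supported_eq_span_single, Submodule.span_le]
  rintro _ ⟨k, -, rfl⟩
  obtain ⟨x, rfl⟩ := k.exists_rep
  exact ⟨_, single_mem_vertexChains x, componentMap_vertex K x⟩

theorem add_mem_boundaries_of_reachable {K : PreAbstractSimplicialComplex V} {x y : V}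
    (h : (edgeGraph K).Reachable x y) :
    Finsupp.single {x} 1 + Finsupp.single {y} 1 ∈ boundaries 0 K := by
  obtain ⟨p⟩ := h
  induction p with
  | nil => simp [ZModModule.add_self]
  | @cons x y z hxy _ ih =>
    simpa only [ZModModule.add_add_add_cancel] using
      add_mem (boundaries_zero_le_iff.1 le_rfl x y hxy) ih

theorem vertexChains_inf_ker_componentMap (K : PreAbstractSimplicialComplex V) :
    vertexChains V ⊓ LinearMap.ker (componentMap K) = boundaries 0 K := by
  apply le_antisymm
  · -- Moving every vertex to the representative of its component changes a chain by a boundary.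
    let s : ((edgeGraph K).ConnectedComponent →₀ ZMod 2) →ₗ[ZMod 2] Chain V :=
      Finsupp.linearCombination (ZMod 2) fun k => Finsupp.single {k.out} 1
    have hs : vertexChains V ≤ (boundaries 0 K).comap (LinearMap.id + s ∘ₗ componentMap K) := by
      refine vertexChains_le_iff.2 fun x => ?_
      have : (edgeGraph K).Reachable x ((edgeGraph K).connectedComponentMk x).out :=
        (SimpleGraph.ConnectedComponent.exact (Quot.out_eq _)).symm
      simpa [s, componentMap_vertex] using add_mem_boundaries_of_reachable this
    rintro a ⟨ha, hker⟩
    simpa [LinearMap.mem_ker.1 hker] using hs ha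
  · refine le_inf (boundaries_zero_le_vertexChains K) (boundaries_zero_le_iff.2 fun x y hxy => ?_)
    rw [LinearMap.mem_ker, map_add, componentMap_vertex, componentMap_vertex,
      SimpleGraph.ConnectedComponent.sound hxy.reachable, ZModModule.add_self]

theorem card_connectedComponent_add_finrank_boundaries [Finite V]
    (K : PreAbstractSimplicialComplex V) :
    Nat.card (edgeGraph K).ConnectedComponent + Module.finrank (ZMod 2) (boundaries 0 K) =
      Nat.card V := by
  have := Fintype.ofFinite (edgeGraph K).ConnectedComponent
  have h := finrank_map_add_finrank_inf_ker (componentMap K) (vertexChains V)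
  rwa [map_componentMap_vertexChains, vertexChains_inf_ker_componentMap, finrank_top,
    Module.finrank_finsupp_self, ← Nat.card_eq_fintype_card, finrank_vertexChains] at h

end Complex

section Filtration

variable {T : Type*} [LinearOrder T] {α β : Type*}

/-- The filtration `K` does not change between the time `s` and the later time `d`, the latter
excluded: `K s` is the value of `K` just before `d`. -/
def IsLastBefore [Preorder α] (K : T → α) (d : WithTop T) (s : T) : Prop :=
  (s : WithTop T) < d ∧ ∀ t : T, (t : WithTop T) < d → K t ≤ K s

theorem exists_isLastBefore [PartialOrder α] [Finite α] {K : T → α} (hK : Monotone K)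
    {d : WithTop T} (hd : ∃ t : T, (t : WithTop T) < d) : ∃ s, IsLastBefore K d s := by
  obtain ⟨s, hs, hmax⟩ := Set.Finite.exists_maximalFor' K {t : T | (t : WithTop T) < d}
    (Set.toFinite _) hd
  exact ⟨s, hs, fun t ht => (le_total t s).elim (fun h => hK h) fun h => hmax ht (hK h)⟩

/-- Every value of the filtration is entered at a definite first time, i.e. the filtration is
continuous from the right. -/
def HasEntryTimes [Preorder α] (K : T → α) : Prop :=
  ∀ t, ∃ b, ∀ s, K t ≤ K s ↔ b ≤ s

theorem HasEntryTimes.prodMk [Preorder α] [Preorder β] {K : T → α} {L : T → β}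
    (hK : HasEntryTimes K) (hL : HasEntryTimes L) : HasEntryTimes fun t => (K t, L t) := by
  intro t
  obtain ⟨b, hb⟩ := hK t
  obtain ⟨c, hc⟩ := hL t
  exact ⟨max b c, fun s => by rw [Prod.mk_le_mk, hb, hc, max_le_iff]⟩

theorem HasEntryTimes.induction [PartialOrder α] [Finite α] {K : T → α} (hmono : Monotone K)
    (hentry : HasEntryTimes K) {o : T} (ho : IsBot o) {P : α → Prop} (start : P (K o))
    (jump : ∀ b s, o < b → IsLastBefore K b s → P (K s) → P (K b)) (t : T) : P (K t) := by
  induction hKt : K t using WellFoundedLT.induction generalizing t with | _ k ih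
  obtain ⟨b, hb⟩ := hentry t
  have hKb : K b = k := hKt ▸ le_antisymm (hmono ((hb t).1 le_rfl)) ((hb b).2 le_rfl)
  obtain rfl | hob := (ho b).eq_or_lt
  · exact hKb ▸ start
  obtain ⟨s, hs⟩ := exists_isLastBefore hmono (d := b) ⟨o, WithTop.coe_lt_coe.2 hob⟩
  have hsb : s < b := WithTop.coe_lt_coe.1 hs.1
  have hlt : K s < k := hKb ▸ (hmono hsb.le).lt_of_ne fun h =>
    hsb.not_ge ((hb s).1 (hKt.trans (hKb.symm.trans h.symm)).le)
  exact hKb ▸ jump b s hob hs (ih _ hlt s rfl)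

end Filtration

section GraphFiltration

instance {V : Type v} [Finite V] : Finite (PreAbstractSimplicialComplex V) :=
  Finite.of_injective _ SetLike.coe_injective

/-- A filtration, starting at time `o`, by `1`-dimensional complexes on all of `V`, i.e. by graphs,
the first of which has no edges. -/
structure IsGraphFiltration {V : Type v} {T : Type*} [LinearOrder T]
    (K : T → PreAbstractSimplicialComplex V) (o : T) : Prop where
  mono : Monotone K
  hasEntryTimes : HasEntryTimes K
  isBot : IsBot o
  singleton_mem : ∀ t x, {x} ∈ K t
  card_le_two : ∀ t, ∀ σ ∈ K t, σ.card ≤ 2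
  edgeGraph_start : edgeGraph (K o) = ⊥

variable {V W : Type v} {T : Type*} [LinearOrder T] {o : T}
  {K : T → PreAbstractSimplicialComplex V} {L : T → PreAbstractSimplicialComplex W}

theorem iSup_deadBy (n : ℕ) {d : WithTop T} {s : T} (hs : IsLastBefore K d s) :
    ⨆ (t : WithTop T) (_ : t < d), deadBy n K t = boundaries n (K s) := by
  refine le_antisymm (iSup₂_le fun t ht => ?_) (le_iSup₂_of_le (s : WithTop T) hs.1 le_rfl)
  cases t with
  | top => exact absurd ht not_top_lt
  | coe t => exact boundaries_mono n (hs.2 t ht)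

theorem iSup_cycles (n : ℕ) {b s : T} (hs : IsLastBefore K b s) :
    ⨆ (t : T) (_ : t < b), cycles n (K t) = cycles n (K s) :=
  le_antisymm (iSup₂_le fun t ht => cycles_mono n (hs.2 t (WithTop.coe_lt_coe.2 ht)))
    (le_iSup₂_of_le s (WithTop.coe_lt_coe.1 hs.1) le_rfl)

theorem iSup_lt_isBot {E : Type*} [CompleteLattice E] (ho : IsBot o) (f : T → E) :
    ⨆ (t : T) (_ : t < o), f t = ⊥ := by
  simp [fun t => (ho t).not_gt]

namespace IsGraphFiltration

theorem le_of_isLastBefore (hK : IsGraphFiltration K o) {b s : T} (hs : IsLastBefore K b s) :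
    K s ≤ K b :=
  hK.mono (WithTop.coe_lt_coe.1 hs.1).le

variable [Finite V] [Finite W]

theorem persistenceDiagram_zero_add (hK : IsGraphFiltration K o) {b s : T} (hob : o < b)
    (hs : IsLastBefore K b s) :
    persistenceDiagram 0 K o b + Module.finrank (ZMod 2) (boundaries 0 (K s)) =
      Module.finrank (ZMod 2) (boundaries 0 (K b)) := by
  rw [persistenceDiagram, if_pos (WithTop.coe_lt_coe.2 hob)]
  simp only [iSup_deadBy 0 hs, iSup_lt_isBot hK.isBot, deadBy_coe, bot_inf_eq, bot_sup_eq,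
    cycles_zero_eq_vertexChains (hK.singleton_mem _),
    inf_eq_right.2 (boundaries_zero_le_vertexChains _)]
  exact quotientDim_add_finrank (boundaries_mono 0 (hK.le_of_isLastBefore hs))

theorem persistenceDiagram_zero_top_add (hK : IsGraphFiltration K o) {s : T}
    (hs : IsLastBefore K ⊤ s) :
    persistenceDiagram 0 K o ⊤ + Module.finrank (ZMod 2) (boundaries 0 (K s)) = Nat.card V := by
  rw [persistenceDiagram, if_pos (WithTop.coe_lt_top o)]
  simp only [iSup_deadBy 0 hs, iSup_lt_isBot hK.isBot, deadBy_top, bot_sup_eq,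
    inf_top_eq, cycles_zero_eq_vertexChains (hK.singleton_mem _),
    inf_eq_right.2 (boundaries_zero_le_vertexChains _)]
  rw [quotientDim_add_finrank (boundaries_zero_le_vertexChains _), finrank_vertexChains]

theorem persistenceDiagram_one_top_add (hK : IsGraphFiltration K o) {b s : T}
    (hs : IsLastBefore K b s) :
    persistenceDiagram 1 K b ⊤ + Module.finrank (ZMod 2) (cycles 1 (K s)) =
      Module.finrank (ZMod 2) (cycles 1 (K b)) := by
  obtain ⟨r, hr⟩ := exists_isLastBefore hK.mono (d := ⊤) ⟨o, WithTop.coe_lt_top o⟩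
  rw [persistenceDiagram, if_pos (WithTop.coe_lt_top b)]
  simp only [iSup_deadBy 1 hr, iSup_cycles 1 hs, deadBy_top,
    boundaries_one_eq_bot (hK.card_le_two r), inf_bot_eq, sup_bot_eq, inf_top_eq]
  exact quotientDim_add_finrank (cycles_mono 1 (hK.le_of_isLastBefore hs))

/-- An entering edge either merges two components or creates a cycle. -/
theorem ncard_edgeSet_eq_add (hK : IsGraphFiltration K o) {b s : T} (hob : o < b)
    (hs : IsLastBefore K b s) :
    (edgeGraph (K b)).edgeSet.ncard =
      (edgeGraph (K s)).edgeSet.ncard +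
        (persistenceDiagram 0 K o b + persistenceDiagram 1 K b ⊤) := by
  rw [← finrank_boundaries_add_finrank_cycles, ← finrank_boundaries_add_finrank_cycles,
    ← hK.persistenceDiagram_zero_add hob hs, ← hK.persistenceDiagram_one_top_add hs]
  ring

theorem finrank_boundaries_eq (hK : IsGraphFiltration K o) (hL : IsGraphFiltration L o)
    (h : persistenceDiagram 0 K = persistenceDiagram 0 L) (t : T) :
    Module.finrank (ZMod 2) (boundaries 0 (K t)) =
      Module.finrank (ZMod 2) (boundaries 0 (L t)) := by
  refine (hK.hasEntryTimes.prodMk hL.hasEntryTimes).induction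
    (P := fun k => Module.finrank (ZMod 2) (boundaries 0 k.1) =
      Module.finrank (ZMod 2) (boundaries 0 k.2))
    (hK.mono.prodMk hL.mono) hK.isBot ?_ (fun b s hob hs ih => ?_) t
  · rw [boundaries_zero_eq_bot hK.edgeGraph_start, boundaries_zero_eq_bot hL.edgeGraph_start,
      finrank_bot, finrank_bot]
  · rw [← hK.persistenceDiagram_zero_add hob ⟨hs.1, fun t ht => (hs.2 t ht).1⟩,
      ← hL.persistenceDiagram_zero_add hob ⟨hs.1, fun t ht => (hs.2 t ht).2⟩, h, ih]

theorem card_eq (hK : IsGraphFiltration K o) (hL : IsGraphFiltration L o)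
    (h : persistenceDiagram 0 K = persistenceDiagram 0 L) : Nat.card V = Nat.card W := by
  obtain ⟨s, hs⟩ := exists_isLastBefore (K := fun t => (K t, L t)) (d := ⊤)
    (hK.mono.prodMk hL.mono) ⟨o, WithTop.coe_lt_top o⟩
  rw [← hK.persistenceDiagram_zero_top_add ⟨hs.1, fun t ht => (hs.2 t ht).1⟩,
    ← hL.persistenceDiagram_zero_top_add ⟨hs.1, fun t ht => (hs.2 t ht).2⟩, h,
    finrank_boundaries_eq hK hL h]

theorem card_connectedComponent_eq (hK : IsGraphFiltration K o) (hL : IsGraphFiltration L o)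
    (h : persistenceDiagram 0 K = persistenceDiagram 0 L) (t : T) :
    Nat.card (edgeGraph (K t)).ConnectedComponent =
      Nat.card (edgeGraph (L t)).ConnectedComponent := by
  have hV := card_connectedComponent_add_finrank_boundaries (K t)
  have hW := card_connectedComponent_add_finrank_boundaries (L t)
  rw [finrank_boundaries_eq hK hL h, card_eq hK hL h, ← hW] at hV
  exact Nat.add_right_cancel hV

end IsGraphFiltration

end GraphFiltration

theorem eq_of_card_eq_of_count_eq {α : Type*} [DecidableEq α] {s t : Multiset α} (a : α)
    (hcard : s.card = t.card) (h : ∀ b ≠ a, s.count b = t.count b) : s = t := by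
  have hne : s.filter (a ≠ ·) = t.filter (a ≠ ·) := by
    ext b
    simp only [Multiset.count_filter]
    split_ifs with hb
    · exact h b hb.symm
    · rfl
  have hsplit (r : Multiset α) : r.count a + (r.filter (a ≠ ·)).card = r.card := by
    rw [Multiset.count_eq_card_filter_eq, ← Multiset.card_add, Multiset.filter_add_not]
  have ha : s.count a = t.count a := by
    have := hsplit s
    have := hsplit t
    rw [hne] at *
    omega
  ext b
  obtain rfl | hb := eq_or_ne b a
  · exact ha
  · exact h b hb

section Rips

/-- A time axis: an interval of nonnegative reals with least element `0`, parametrized by `ι`. -/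
structure IsTimeAxis {T : Type*} [LinearOrder T] (ι : T → ℝ) (o : T) : Prop where
  strictMono : StrictMono ι
  map_start : ι o = 0
  isBot : IsBot o
  exists_eq : ∀ t r, 0 ≤ r → r ≤ ι t → ∃ s, ι s = r

theorem isTimeAxis_nnreal : IsTimeAxis (fun t : ℝ≥0 => (t : ℝ)) 0 where
  strictMono _ _ h := h
  map_start := rfl
  isBot _ := zero_le
  exists_eq _ r hr _ := ⟨⟨r, hr⟩, rfl⟩

theorem isTimeAxis_Icc {r : ℝ} (hr : 0 ≤ r) :
    IsTimeAxis (fun t : Set.Icc 0 r => (t : ℝ)) ⟨0, le_rfl, hr⟩ where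
  strictMono _ _ h := h
  map_start := rfl
  isBot t := t.2.1
  exists_eq t a ha h := ⟨⟨a, ha, h.trans t.2.2⟩, rfl⟩

variable {V W : Type v} {T : Type*}

open Classical in
/-- The distance matrix of a weighting of the pairs of points. The weights of the diagonal pairs
play no role. -/
def weightMatrix (w : Sym2 V → EReal) (x y : V) : EReal :=
  if x = y then 0 else w s(x, y)

/-- The filtration of the `1`-skeletons of the Vietoris-Rips complexes of a weighting. -/
def ripsFiltration (ι : T → ℝ) (w : Sym2 V → EReal) (t : T) : PreAbstractSimplicialComplex V :=
  vietorisRips 1 (weightMatrix w) (ι t)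

/-- Every pair enters the Vietoris-Rips filtration at a positive time, or never. -/
def IsTimed (ι : T → ℝ) (w : Sym2 V → EReal) : Prop :=
  ∀ e, ¬ e.IsDiag → w e = ⊤ ∨ ∃ t, 0 < ι t ∧ w e = ι t

open Classical in
/-- The multiset of the weights of all pairs of distinct points. -/
def weights [Fintype V] (w : Sym2 V → EReal) : Multiset EReal :=
  (⊤ : SimpleGraph V).edgeFinset.val.map w

theorem card_weights [Fintype V] (w : Sym2 V → EReal) :
    (weights w).card = (Nat.card V).choose 2 := by
  classical
  rw [weights, Multiset.card_map, Finset.card_val, Nat.card_eq_fintype_card,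
    ← SimpleGraph.card_edgeFinset_top_eq_card_choose_two]

open Classical in
theorem count_weights [Fintype V] (w : Sym2 V → EReal) (a : EReal) :
    (weights w).count a = {e | ¬ e.IsDiag ∧ w e = a}.ncard := by
  rw [weights, Multiset.count_map, ← Finset.filter_val, Finset.card_val,
    ← Set.ncard_coe_finset]
  congr 1
  ext e
  simp [eq_comm]

theorem ripsFiltration_edgeSet {ι : T → ℝ} {t : T} (ht : 0 ≤ ι t) (w : Sym2 V → EReal) :
    (edgeGraph (ripsFiltration ι w t)).edgeSet = {e | ¬ e.IsDiag ∧ w e ≤ ι t} := by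
  classical
  have ht' : (0 : EReal) ≤ ι t := EReal.coe_nonneg.2 ht
  ext ⟨x, y⟩
  change (x ≠ y ∧ {x, y} ∈ ripsFiltration ι w t) ↔ x ≠ y ∧ w s(x, y) ≤ ι t
  refine and_congr_right fun hxy => ?_
  change (_ ∧ _ ∧ _) ↔ _
  simp [weightMatrix, hxy, hxy.symm, ht', Sym2.eq_swap (a := y)]

theorem IsTimed.pos {ι : T → ℝ} {w : Sym2 V → EReal} (hw : IsTimed ι w)
    {e : Sym2 V} (he : ¬ e.IsDiag) : 0 < w e := by
  obtain h | ⟨t, ht, h⟩ := hw e he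
  · exact h ▸ EReal.zero_lt_top
  · exact h ▸ EReal.coe_pos.2 ht

variable [LinearOrder T] {ι : T → ℝ} {o : T} {w : Sym2 V → EReal} {w' : Sym2 W → EReal}

/-- The `0`-th and the `1`-st persistence diagram of the Vietoris-Rips filtration of a weighting. -/
def ripsDiagrams (ι : T → ℝ) (w : Sym2 V → EReal) : (T → WithTop T → ℕ) × (T → WithTop T → ℕ) :=
  (persistenceDiagram 0 (ripsFiltration ι w), persistenceDiagram 1 (ripsFiltration ι w))

namespace IsTimeAxis

theorem nonneg (hι : IsTimeAxis ι o) (t : T) : 0 ≤ ι t :=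
  hι.map_start ▸ hι.strictMono.monotone (hι.isBot t)

theorem exists_eq_coe (hι : IsTimeAxis ι o) {t : T} {a : EReal} (h0 : 0 ≤ a) (h : a ≤ ι t) :
    ∃ s, a = ι s := by
  lift a to ℝ using ⟨ne_top_of_le_ne_top (EReal.coe_ne_top _) h,
    ne_bot_of_le_ne_bot EReal.zero_ne_bot h0⟩
  obtain ⟨s, rfl⟩ := hι.exists_eq t a (EReal.coe_nonneg.1 h0) (EReal.coe_le_coe_iff.1 h)
  exact ⟨s, rfl⟩

theorem ripsFiltration_le_iff (hι : IsTimeAxis ι o) {s t : T} :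
    ripsFiltration ι w s ≤ ripsFiltration ι w t ↔
      ∀ e ∈ (edgeGraph (ripsFiltration ι w s)).edgeSet, w e ≤ ι t := by
  classical
  constructor
  · rintro h ⟨x, y⟩ ⟨hne, hmem⟩
    have : s(x, y) ∈ (edgeGraph (ripsFiltration ι w t)).edgeSet := ⟨hne, h hmem⟩
    rw [ripsFiltration_edgeSet (hι.nonneg t)] at this
    exact this.2
  · rw [ripsFiltration_edgeSet (hι.nonneg s)]
    rintro h σ ⟨hne, hcard, hσ⟩
    refine ⟨hne, hcard, fun x hx y hy => ?_⟩
    have hxy := hσ x hx y hy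
    rw [weightMatrix] at hxy ⊢
    split_ifs with heq
    · exact EReal.coe_nonneg.2 (hι.nonneg t)
    · exact h _ ⟨heq, by rwa [if_neg heq] at hxy⟩

theorem isGraphFiltration_ripsFiltration (hι : IsTimeAxis ι o) (hw : IsTimed ι w) :
    IsGraphFiltration (ripsFiltration ι w) o where
  mono s t hst := hι.ripsFiltration_le_iff.2 fun e he => by
    rw [ripsFiltration_edgeSet (hι.nonneg s)] at he
    exact he.2.trans (EReal.coe_le_coe_iff.2 (hι.strictMono.monotone hst))
  hasEntryTimes t := by
    obtain ⟨b, hb⟩ := hι.exists_eq_coe (t := t) le_sup_left (sup_le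
      (EReal.coe_nonneg.2 (hι.nonneg t)) (iSup₂_le (hι.ripsFiltration_le_iff (w := w).1 le_rfl)))
    refine ⟨b, fun s => ?_⟩
    rw [hι.ripsFiltration_le_iff, ← hι.strictMono.le_iff_le, ← EReal.coe_le_coe_iff, ← hb,
      sup_le_iff, iSup₂_le_iff, and_iff_right (EReal.coe_nonneg.2 (hι.nonneg s))]
  isBot := hι.isBot
  singleton_mem t x := by
    refine ⟨Finset.singleton_nonempty x, by simp, ?_⟩
    simpa [weightMatrix] using hι.nonneg t
  card_le_two _ _ hσ := hσ.2.1
  edgeGraph_start := by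
    rw [← SimpleGraph.edgeSet_eq_empty, ripsFiltration_edgeSet (hι.nonneg o), hι.map_start]
    exact Set.eq_empty_of_forall_notMem fun e he => (hw.pos he.1).not_ge he.2

theorem le_iff_lt_of_isLastBefore (hι : IsTimeAxis ι o) (hw : IsTimed ι w) {b s : T}
    (hs : IsLastBefore (ripsFiltration ι w) b s) {e : Sym2 V} (he : ¬ e.IsDiag) :
    w e ≤ ι s ↔ w e < ι b := by
  refine ⟨fun h => h.trans_lt (EReal.coe_lt_coe_iff.2 (hι.strictMono (by simpa using hs.1))),
    fun h => ?_⟩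
  obtain ⟨t, ht⟩ := hι.exists_eq_coe (hw.pos he).le h.le
  have htb : t < b := hι.strictMono.lt_iff_lt.1 (EReal.coe_lt_coe_iff.1 (ht ▸ h))
  refine hι.ripsFiltration_le_iff.1 (hs.2 t (WithTop.coe_lt_coe.2 htb)) e ?_
  rw [ripsFiltration_edgeSet (hι.nonneg t)]
  exact ⟨he, ht.le⟩

theorem ncard_weight_eq (hι : IsTimeAxis ι o) [Finite V] (hw : IsTimed ι w) {b : T}
    (hob : o < b) :
    {e | ¬ e.IsDiag ∧ w e = ι b}.ncard =
      persistenceDiagram 0 (ripsFiltration ι w) o b +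
        persistenceDiagram 1 (ripsFiltration ι w) b ⊤ := by
  have hK := hι.isGraphFiltration_ripsFiltration hw
  obtain ⟨s, hs⟩ := exists_isLastBefore hK.mono (d := b) ⟨o, WithTop.coe_lt_coe.2 hob⟩
  have hunion : {e | ¬ e.IsDiag ∧ w e ≤ ι b} =
      {e | ¬ e.IsDiag ∧ w e ≤ ι s} ∪ {e | ¬ e.IsDiag ∧ w e = ι b} := by
    ext e
    simp only [Set.mem_ofPred_eq, Set.mem_union, ← and_or_left]
    exact and_congr_right fun he => by
      rw [hι.le_iff_lt_of_isLastBefore hw hs he, le_iff_lt_or_eq]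
  have hdisj : Disjoint {e | ¬ e.IsDiag ∧ w e ≤ ι s} {e | ¬ e.IsDiag ∧ w e = ι b} :=
    Set.disjoint_left.2 fun e he he' =>
      ((hι.le_iff_lt_of_isLastBefore hw hs he.1).1 he.2).ne he'.2
  have h := hK.ncard_edgeSet_eq_add hob hs
  rw [ripsFiltration_edgeSet (hι.nonneg b), ripsFiltration_edgeSet (hι.nonneg s), hunion,
    Set.ncard_union_eq hdisj] at h
  exact Nat.add_left_cancel h

theorem weights_eq (hι : IsTimeAxis ι o) [Fintype V] [Fintype W] (hw : IsTimed ι w)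
    (hw' : IsTimed ι w') (h : ripsDiagrams ι w = ripsDiagrams ι w') : weights w = weights w' := by
  classical
  obtain ⟨h0, h1⟩ := Prod.ext_iff.1 h
  dsimp only [ripsDiagrams] at h0 h1
  refine eq_of_card_eq_of_count_eq ⊤ ?_ fun a ha => ?_
  · rw [card_weights, card_weights, (hι.isGraphFiltration_ripsFiltration hw).card_eq
      (hι.isGraphFiltration_ripsFiltration hw') h0]
  · by_cases hb : ∃ b, 0 < ι b ∧ a = ι b
    · obtain ⟨b, hb, rfl⟩ := hb
      have hob : o < b := hι.strictMono.lt_iff_lt.1 (hι.map_start ▸ hb)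
      rw [count_weights, count_weights, hι.ncard_weight_eq hw hob, hι.ncard_weight_eq hw' hob,
        h0, h1]
    · have hcount {U : Type v} [Fintype U] {u : Sym2 U → EReal} (hu : IsTimed ι u) :
          (weights u).count a = 0 := by
        rw [count_weights, Set.ncard_eq_zero]
        exact Set.eq_empty_of_forall_notMem fun e ⟨he, hea⟩ =>
          (hu e he).elim (fun h => ha (hea.symm.trans h)) fun ⟨t, ht, h⟩ =>
            hb ⟨t, ht, hea.symm.trans h⟩
      rw [hcount hw, hcount hw']

end IsTimeAxis

end Rips

section EdgeColors

variable {V W : Type v} {α : Type*}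

open Classical in
/-- The multiset of the colored edges of a colored graph. -/
def edgeColorMultiset [Fintype V] (g : SimpleGraph V) (c : V → α) : Multiset (Sym2 α) :=
  g.edgeFinset.val.map (Sym2.map c)

theorem count_toMultiset_map [Fintype V] [DecidableEq V] [DecidableEq α] (c : V → α) (k : α)
    {e : Sym2 V} (he : ¬ e.IsDiag) :
    (e.map c).toMultiset.count k = (Finset.univ.filter fun x => c x = k ∧ x ∈ e).card := by
  induction e with | _ x y
  have hxy : x ≠ y := he
  have hends : (Finset.univ.filter fun z => c z = k ∧ z ∈ s(x, y)) =
      ({x, y} : Finset V).filter fun z => c z = k := by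
    ext z
    simp [and_comm]
  have hmap : (Sym2.map c s(x, y)).toMultiset = {c x, c y} := rfl
  rw [hends, Finset.card_filter, Finset.sum_pair hxy, hmap, Multiset.insert_eq_cons,
    Multiset.count_cons, Multiset.count_singleton, add_comm]
  simp only [eq_comm]

open Classical in
theorem sum_degree_eq_count [Fintype V] (g : SimpleGraph V) (c : V → α) (k : α) :
    ∑ x with c x = k, g.degree x =
      ((edgeColorMultiset g c).bind Sym2.toMultiset).count k := by
  have hdegree (x : V) : g.degree x = (g.edgeFinset.filter fun e => x ∈ e).card := by
    rw [← SimpleGraph.card_incidenceFinset_eq_degree, SimpleGraph.incidenceFinset_eq_filter]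
  have hcount := Finset.sum_card_bipartiteAbove_eq_sum_card_bipartiteBelow
    (s := Finset.univ.filter fun x => c x = k) (t := g.edgeFinset) (fun x e => x ∈ e)
  simp only [Finset.bipartiteAbove, Finset.bipartiteBelow, Finset.filter_filter, ← hdegree]
    at hcount
  rw [hcount, Multiset.count_bind, edgeColorMultiset, Multiset.map_map]
  refine Finset.sum_congr rfl fun e he => (count_toMultiset_map c k ?_).symm
  exact g.not_isDiag_of_mem_edgeSet (SimpleGraph.mem_edgeFinset.1 he)

open Classical in
theorem count_map_mul_eq_count [Fintype V] {g : SimpleGraph V} {c : V → α} {k : α} {d : ℕ}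
    (hd : ∀ x, c x = k → g.degree x = d) :
    (Finset.univ.val.map c).count k * d =
      ((edgeColorMultiset g c).bind Sym2.toMultiset).count k := by
  rw [← sum_degree_eq_count,
    Finset.sum_congr rfl fun x hx => hd x (Finset.mem_filter.1 hx).2, Finset.sum_const,
    smul_eq_mul, Multiset.count_map, Finset.card_def, Finset.filter_val]
  simp only [eq_comm]

open Classical in
/-- The color of a pair of nodes: `none` unless the nodes are adjacent. -/
def pairColor (g : SimpleGraph V) (c : V → α) (e : Sym2 V) : Option (Sym2 α) :=
  if e ∈ g.edgeSet then some (e.map c) else none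

theorem pairColor_of_mem {g : SimpleGraph V} {c : V → α} {e : Sym2 V} (he : e ∈ g.edgeSet) :
    pairColor g c e = some (e.map c) :=
  if_pos he

theorem pairColor_of_notMem {g : SimpleGraph V} {c : V → α} {e : Sym2 V} (he : e ∉ g.edgeSet) :
    pairColor g c e = none :=
  if_neg he

open Classical in
theorem filterMap_pairColor [Fintype V] (g : SimpleGraph V) (c : V → α) :
    (⊤ : SimpleGraph V).edgeFinset.val.filterMap (pairColor g c) = edgeColorMultiset g c := by
  have hedges : g.edgeFinset = (⊤ : SimpleGraph V).edgeFinset.filter (· ∈ g.edgeSet) := by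
    ext e
    simpa using g.not_isDiag_of_mem_edgeSet
  rw [edgeColorMultiset, hedges, Finset.filter_val, ← Multiset.filterMap_eq_filter,
    Multiset.map_filterMap]
  congr 1
  ext1 e
  by_cases he : e ∈ g.edgeSet <;> simp [pairColor, Option.guard, he]

theorem map_eq_map_of_forall {ι ι' β γ : Type*} {s : Multiset ι} {t : Multiset ι'}
    {f : ι → β} {f' : ι' → β} {p : ι → γ} {p' : ι' → γ} (h : s.map f = t.map f')
    (hp : ∀ a ∈ s, ∀ b ∈ t, f a = f' b → p a = p' b) : s.map p = t.map p' := by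
  rw [← Multiset.rel_eq, Multiset.rel_map] at h ⊢
  exact h.mono hp

theorem edgeColorMultiset_eq_of_weights_eq [Fintype V] [Fintype W] {g : SimpleGraph V}
    {c : V → α} {h : SimpleGraph W} {c' : W → α} {w : Sym2 V → EReal} {w' : Sym2 W → EReal}
    (hw : weights w = weights w')
    (hcolor : ∀ e e', ¬ e.IsDiag → ¬ e'.IsDiag → w e = w' e' →
      pairColor g c e = pairColor h c' e') :
    edgeColorMultiset g c = edgeColorMultiset h c' := by
  classical
  rw [← filterMap_pairColor, ← filterMap_pairColor, ← Function.id_comp (pairColor g c),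
    ← Function.id_comp (pairColor h c'), ← Multiset.filterMap_map, ← Multiset.filterMap_map]
  refine congrArg (Multiset.filterMap id) (map_eq_map_of_forall hw fun e he e' he' => ?_)
  exact hcolor e e' (by simpa using he) (by simpa using he')

end EdgeColors

section NodeColors

variable {𝒢 : GraphSpace.{u, v}} {N : ℕ} {C : NodeColoring 𝒢 N} {G H : 𝒢.Idx}

theorem DegreeAssumption.count_colorMultiset_eq (hC : DegreeAssumption C)
    (he : edgeColorMultiset (𝒢.graph G) (C G) = edgeColorMultiset (𝒢.graph H) (C H))
    [DecidableEq (Feature N)] {k : Feature N}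
    (hk : ∀ J ∈ ({G, H} : Set 𝒢.Idx), ∀ x, C J x = k → ∃ y, (𝒢.graph J).Adj x y) :
    (colorMultiset C G).count k = (colorMultiset C H).count k := by
  classical
  by_cases hused : ∃ J ∈ ({G, H} : Set 𝒢.Idx), ∃ x, C J x = k
  · obtain ⟨J, hJ, x, rfl⟩ := hused
    have hmul (I : 𝒢.Idx) : (colorMultiset C I).count (C J x) * (𝒢.graph J).degree x =
        ((edgeColorMultiset (𝒢.graph I) (C I)).bind Sym2.toMultiset).count (C J x) := by
      convert count_map_mul_eq_count fun y hy => hC I J y x hy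
      rfl
    refine Nat.eq_of_mul_eq_mul_right ?_ ((hmul G).trans (he ▸ (hmul H).symm))
    exact ((𝒢.graph J).degree_pos_iff_exists_adj x).2 (hk J hJ x rfl)
  · push Not at hused
    rw [Multiset.count_eq_zero_of_notMem, Multiset.count_eq_zero_of_notMem] <;>
      simp [colorMultiset, hused]

theorem DegreeAssumption.colorMultiset_eq (hC : DegreeAssumption C)
    (he : edgeColorMultiset (𝒢.graph G) (C G) = edgeColorMultiset (𝒢.graph H) (C H))
    (hG : NoIsolated (𝒢.graph G)) (hH : NoIsolated (𝒢.graph H)) :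
    colorMultiset C G = colorMultiset C H := by
  classical
  refine Multiset.ext.2 fun k => hC.count_colorMultiset_eq he ?_
  rintro J (rfl | rfl) x -
  exacts [hG x, hH x]

theorem IsStableWL.degreeAssumption (hC : IsStableWL C) : DegreeAssumption C := by
  intro G H x y hxy
  have hround : wlColor (𝒢.graph G) 1 x = wlColor (𝒢.graph H) 1 y := (hC G H x y).1 hxy 1
  have hcard : Multiset.card _ = Multiset.card _ := congrArg (fun p => Multiset.card p.2) hround
  exact (Multiset.card_map _ _).symm.trans (hcard.trans (Multiset.card_map _ _))

theorem IsStableWL.eq_of_isolated (hC : IsStableWL C) {x : 𝒢.V G} {y : 𝒢.V H}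
    (hx : ¬ ∃ z, (𝒢.graph G).Adj x z) (hy : ¬ ∃ z, (𝒢.graph H).Adj y z) : C G x = C H y := by
  classical
  have hempty {J : 𝒢.Idx} {z : 𝒢.V J} (hz : ¬ ∃ z', (𝒢.graph J).Adj z z') :
      (𝒢.graph J).neighborFinset z = ∅ := by
    ext z'
    simpa using not_exists.1 hz z'
  refine (hC G H x y).2 fun t => ?_
  induction t with
  | zero => rfl
  | succ t ih =>
    refine Prod.ext ih ?_
    change ((𝒢.graph G).neighborFinset x).val.map _ = ((𝒢.graph H).neighborFinset y).val.map _
    rw [hempty hx, hempty hy]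
    rfl

/-- All isolated nodes have the same color, whose multiplicity is determined by the number of nodes
and the other multiplicities. -/
theorem IsStableWL.colorMultiset_eq (hC : IsStableWL C)
    (he : edgeColorMultiset (𝒢.graph G) (C G) = edgeColorMultiset (𝒢.graph H) (C H))
    (hcard : Nat.card (𝒢.V G) = Nat.card (𝒢.V H)) :
    colorMultiset C G = colorMultiset C H := by
  classical
  by_cases hiso : ∃ (J : 𝒢.Idx) (z : 𝒢.V J), ¬ ∃ z', (𝒢.graph J).Adj z z'
  · obtain ⟨J, z, hz⟩ := hiso
    refine eq_of_card_eq_of_count_eq (C J z) (by simpa [colorMultiset] using hcard) fun k hk => ?_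
    refine hC.degreeAssumption.count_colorMultiset_eq he fun I _ x hx => ?_
    by_contra hx'
    exact hk (hx.symm.trans (hC.eq_of_isolated hx' hz))
  · push Not at hiso
    exact hC.degreeAssumption.colorMultiset_eq he (hiso G) (hiso H)

open Classical in
theorem wlColor_eq_of_isRegularOfDegree {V W : Type v} [Fintype V] [Fintype W]
    {g : SimpleGraph V} {h : SimpleGraph W} {d : ℕ} (hg : g.IsRegularOfDegree d)
    (hh : h.IsRegularOfDegree d) (t : ℕ) (x : V) (y : W) : wlColor g t x = wlColor h t y := by
  induction t generalizing x y with
  | zero => rfl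
  | succ t ih =>
    have hconst : ∀ x', wlColor g t x' = wlColor h t y := fun x' => ih x' y
    have hconst' : ∀ y', wlColor h t y' = wlColor h t y := fun y' => (ih x y').symm.trans (ih x y)
    refine Prod.ext (ih x y) ?_
    change (g.neighborFinset x).val.map _ = (h.neighborFinset y).val.map _
    rw [Multiset.map_congr rfl fun x' _ => hconst x', Multiset.map_congr rfl fun y' _ => hconst' y',
      Multiset.map_const', Multiset.map_const']
    exact congrArg (Multiset.replicate · _) ((hg x).trans (hh y).symm)

theorem colorMultiset_eq_of_const {k : Feature N} (hG : ∀ x, C G x = k) (hH : ∀ x, C H x = k)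
    (hcard : Nat.card (𝒢.V G) = Nat.card (𝒢.V H)) : colorMultiset C G = colorMultiset C H := by
  rw [Nat.card_eq_fintype_card, Nat.card_eq_fintype_card] at hcard
  simp [colorMultiset, hG, hH, hcard]

end NodeColors

section ColorFiltrations

variable {𝒢 : GraphSpace.{u, v}} {N : ℕ} {C : NodeColoring 𝒢 N} {T : Type*} {ι : T → ℝ}
  {w : ∀ G, Sym2 (𝒢.V G) → EReal}

open Classical in
/-- A weighting of the pairs of nodes of every graph from which the coloring can be read off: the
weight of a pair determines whether it is an edge, and of which color, and the monochromatic regular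
graphs of a given color and degree appear in their filtrations at a common time. -/
structure IsColorFiltration (C : NodeColoring 𝒢 N) (ι : T → ℝ)
    (w : ∀ G, Sym2 (𝒢.V G) → EReal) : Prop where
  isTimed : ∀ G, IsTimed ι (w G)
  pairColor_eq : ∀ {G H e e'}, ¬ e.IsDiag → ¬ e'.IsDiag → w G e = w H e' →
    pairColor (𝒢.graph G) (C G) e = pairColor (𝒢.graph H) (C H) e'
  exists_edgeGraph_eq : ∀ {k d}, s(k, k) ∈ coloredEdges C → 0 < d → ∃ t, ∀ G, (∀ x, C G x = k) →
    (𝒢.graph G).IsRegularOfDegree d → edgeGraph (ripsFiltration ι (w G) t) = 𝒢.graph G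

namespace IsColorFiltration

variable [LinearOrder T] {o : T} {G H : 𝒢.Idx}

theorem card_eq (hw : IsColorFiltration C ι w) (hι : IsTimeAxis ι o)
    (h : ripsDiagrams ι (w G) = ripsDiagrams ι (w H)) : Nat.card (𝒢.V G) = Nat.card (𝒢.V H) :=
  (hι.isGraphFiltration_ripsFiltration (hw.isTimed G)).card_eq
    (hι.isGraphFiltration_ripsFiltration (hw.isTimed H)) (Prod.ext_iff.1 h).1

theorem edgeColorMultiset_eq (hw : IsColorFiltration C ι w) (hι : IsTimeAxis ι o)
    (h : ripsDiagrams ι (w G) = ripsDiagrams ι (w H)) :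
    edgeColorMultiset (𝒢.graph G) (C G) = edgeColorMultiset (𝒢.graph H) (C H) :=
  edgeColorMultiset_eq_of_weights_eq (hι.weights_eq (hw.isTimed G) (hw.isTimed H) h)
    fun _ _ => hw.pairColor_eq

theorem ripsDiagrams_ne_of_degreeAssumption (hw : IsColorFiltration C ι w) (hι : IsTimeAxis ι o)
    (hC : DegreeAssumption C) (hG : NoIsolated (𝒢.graph G)) (hH : NoIsolated (𝒢.graph H))
    (hne : colorMultiset C G ≠ colorMultiset C H) :
    ripsDiagrams ι (w G) ≠ ripsDiagrams ι (w H) :=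
  fun h => hne (hC.colorMultiset_eq (hw.edgeColorMultiset_eq hι h) hG hH)

theorem ripsDiagrams_ne_of_isStableWL (hw : IsColorFiltration C ι w) (hι : IsTimeAxis ι o)
    (hC : IsStableWL C) (hne : colorMultiset C G ≠ colorMultiset C H) :
    ripsDiagrams ι (w G) ≠ ripsDiagrams ι (w H) :=
  fun h => hne (hC.colorMultiset_eq (hw.edgeColorMultiset_eq hι h) (hw.card_eq hι h))

open Classical in
theorem ripsDiagrams_ne_of_isRegularOfDegree (hw : IsColorFiltration C ι w)
    (hι : IsTimeAxis ι o) {k : Feature N} {d : ℕ} (hk : s(k, k) ∈ coloredEdges C) (hd : 0 < d)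
    (hCG : ∀ x, C G x = k) (hCH : ∀ x, C H x = k) (hG : (𝒢.graph G).IsRegularOfDegree d)
    (hH : (𝒢.graph H).IsRegularOfDegree d)
    (hne : Nat.card (𝒢.graph G).ConnectedComponent ≠ Nat.card (𝒢.graph H).ConnectedComponent) :
    ripsDiagrams ι (w G) ≠ ripsDiagrams ι (w H) := by
  intro h
  obtain ⟨t, ht⟩ := hw.exists_edgeGraph_eq hk hd
  have hcomponents := (hι.isGraphFiltration_ripsFiltration
    (hw.isTimed G)).card_connectedComponent_eq
      (hι.isGraphFiltration_ripsFiltration (hw.isTimed H)) (Prod.ext_iff.1 h).1 t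
  rw [ht G hCG hG, ht H hCH hH] at hcomponents
  exact hne hcomponents

end IsColorFiltration

end ColorFiltrations

section TED

variable {𝒢 : GraphSpace.{u, v}} {N : ℕ}

open Classical in
/-- The weights of the pairs of nodes in the filtration of the topological edge diagram. -/
def tedWeight (C : NodeColoring 𝒢 N) (ef : Sym2 (Feature N) → ℝ) (G : 𝒢.Idx)
    (e : Sym2 (𝒢.V G)) : EReal :=
  if e ∈ (𝒢.graph G).edgeSet then (ef (e.map (C G)) : EReal) else ⊤

theorem TED_eq_ripsDiagrams (C : NodeColoring 𝒢 N) (ef : Sym2 (Feature N) → ℝ) (G : 𝒢.Idx) :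
    TED C ef G = ripsDiagrams (fun t : ℝ≥0 => (t : ℝ)) (tedWeight C ef G) :=
  rfl

theorem map_mem_coloredEdges (C : NodeColoring 𝒢 N) {G : 𝒢.Idx} {e : Sym2 (𝒢.V G)}
    (he : e ∈ (𝒢.graph G).edgeSet) : e.map (C G) ∈ coloredEdges C := by
  induction e with | _ x y
  exact ⟨G, x, y, he, rfl⟩

theorem map_const_eq {α β : Type*} {c : α → β} {k : β} (hc : ∀ x, c x = k) (e : Sym2 α) :
    e.map c = s(k, k) := by
  induction e with | _ x y
  rw [Sym2.map_mk, hc, hc]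

theorem IsInjectiveEdgeFiltration.isColorFiltration {C : NodeColoring 𝒢 N}
    {ef : Sym2 (Feature N) → ℝ} (hef : IsInjectiveEdgeFiltration C ef) :
    IsColorFiltration C (fun t : ℝ≥0 => (t : ℝ)) (tedWeight C ef) where
  isTimed G e _ := by
    rw [tedWeight]
    split_ifs with he
    · have hpos := hef.pos _ (map_mem_coloredEdges C he)
      exact .inr ⟨⟨_, hpos.le⟩, hpos, rfl⟩
    · exact .inl rfl
  pairColor_eq {G H e e'} _ _ h := by
    rw [tedWeight, tedWeight] at h
    split_ifs at h with he he' he'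
    · rw [pairColor_of_mem he, pairColor_of_mem he']
      exact congrArg some (hef.inj (map_mem_coloredEdges C he) (map_mem_coloredEdges C he')
        (EReal.coe_injective h))
    · exact absurd h (EReal.coe_ne_top _)
    · exact absurd h.symm (EReal.coe_ne_top _)
    · rw [pairColor_of_notMem he, pairColor_of_notMem he']
  exists_edgeGraph_eq {k d} hk _ := by
    obtain ⟨t, ht⟩ : ∃ t : ℝ≥0, (t : ℝ) = ef s(k, k) := ⟨⟨_, (hef.pos _ hk).le⟩, rfl⟩
    refine ⟨t, fun G hG _ => ?_⟩
    rw [← SimpleGraph.edgeSet_inj, ripsFiltration_edgeSet t.coe_nonneg]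
    ext e
    rw [Set.mem_ofPred_eq, tedWeight, map_const_eq hG, ht]
    split_ifs with he
    · simp [he, (𝒢.graph G).not_isDiag_of_mem_edgeSet he]
    · simp [he]

end TED

section GenericParameters

theorem countable_addSubmonoid_closure {M : Type*} [AddMonoid M] {s : Set M} (hs : s.Countable) :
    (AddSubmonoid.closure s : Set M).Countable := by
  have := hs.to_subtype
  refine (Set.countable_range fun l : List s => (l.map Subtype.val).sum).mono fun x hx => ?_
  obtain ⟨l, hl, rfl⟩ := AddSubmonoid.exists_list_of_mem_closure hx
  lift l to List s using hl
  exact ⟨l, rfl⟩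

theorem countable_sym2 {α : Type*} {s : Set α} (hs : s.Countable) : s.sym2.Countable := by
  rw [Set.sym2_eq_mk_image]
  exact (hs.prod hs).image _

variable {E : Type*} [AddCommGroup E] [Module ℝ E] {ε : ℝ} {X : Set E}

/-- The arguments that the perceptron of a layer of a graph isomorphism network may get when the
features of all nodes belong to `X`. -/
def ginInputs (ε : ℝ) (X : Set E) : Set E :=
  Set.image2 (fun x s => (1 + ε) • x + s) X (AddSubmonoid.closure X)

theorem countable_ginInputs (ε : ℝ) (hX : X.Countable) : (ginInputs ε X).Countable :=
  hX.image2 (countable_addSubmonoid_closure hX) _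

theorem smul_add_sum_mem_ginInputs {ι : Type*} {x : E} {t : Finset ι} {f : ι → E} (hx : x ∈ X)
    (hf : ∀ i ∈ t, f i ∈ X) : (1 + ε) • x + ∑ i ∈ t, f i ∈ ginInputs ε X :=
  Set.mem_image2_of_mem hx (sum_mem fun i hi => AddSubmonoid.subset_closure (hf i hi))

/-- The parameter `ε` of a layer of a graph isomorphism network with features in `X` is such that
the argument of the perceptron at a node determines the feature of the node. -/
def SeparatesCenters (ε : ℝ) (X : Set E) : Prop :=
  ∀ x ∈ X, ∀ x' ∈ X, ∀ s ∈ AddSubmonoid.closure X, ∀ s' ∈ AddSubmonoid.closure X,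
    (1 + ε) • x + s = (1 + ε) • x' + s' → x = x'

theorem SeparatesCenters.eq {ι κ : Type*} {x x' : E} {t : Finset ι} {u : Finset κ} {f : ι → E}
    {f' : κ → E} (h : SeparatesCenters ε X) (hx : x ∈ X) (hx' : x' ∈ X)
    (hf : ∀ i ∈ t, f i ∈ X) (hf' : ∀ i ∈ u, f' i ∈ X)
    (heq : (1 + ε) • x + ∑ i ∈ t, f i = (1 + ε) • x' + ∑ i ∈ u, f' i) : x = x' :=
  h x hx x' hx' _ (sum_mem fun i hi => AddSubmonoid.subset_closure (hf i hi))
    _ (sum_mem fun i hi => AddSubmonoid.subset_closure (hf' i hi)) heq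

theorem subsingleton_setOf_smul_add_eq {x x' : E} (hx : x ≠ x') (s s' : E) :
    {ε : ℝ | (1 + ε) • x + s = (1 + ε) • x' + s'}.Subsingleton := by
  intro a ha b hb
  have hsmul : a • (x - x') = b • (x - x') := by
    have hsub := congrArg₂ (· - ·) (Set.mem_ofPred_eq.mp ha) (Set.mem_ofPred_eq.mp hb)
    linear_combination (norm := module) hsub
  exact smul_left_injective ℝ (sub_ne_zero.2 hx) hsmul

theorem exists_separatesCenters (hX : X.Countable) : ∃ ε : ℝ, 1 < ε ∧ SeparatesCenters ε X := by
  let S : Set E := AddSubmonoid.closure X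
  have hS : S.Countable := countable_addSubmonoid_closure hX
  have hbad : (⋃ p ∈ X.offDiag ×ˢ (S ×ˢ S),
      {ε : ℝ | (1 + ε) • p.1.1 + p.2.1 = (1 + ε) • p.1.2 + p.2.2}).Countable :=
    ((hX.prod hX).mono X.offDiag_subset_prod |>.prod (hS.prod hS)).biUnion fun p hp =>
      (subsingleton_setOf_smul_add_eq hp.1.2.2 _ _).countable
  obtain ⟨ε, hε, hgood⟩ := (hbad.dense_compl ℝ).inter_open_nonempty (Set.Ioi 1) isOpen_Ioi
    Set.nonempty_Ioi
  refine ⟨ε, hε, fun x hx x' hx' s hs s' hs' heq => ?_⟩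
  by_contra hne
  exact hgood (Set.mem_biUnion (x := ((x, x'), (s, s'))) ⟨⟨hx, hx', hne⟩, hs, hs'⟩ heq)

open MeasureTheory in
theorem exists_injOn_dotProduct {ι : Type*} [Fintype ι] {Y : Set (ι → ℝ)} (hY : Y.Countable) :
    ∃ w : ι → ℝ, Set.InjOn (w ⬝ᵥ ·) Y := by
  have hoffDiag : Y.offDiag.Countable := (hY.prod hY).mono Y.offDiag_subset_prod
  have hpair : ∀ p ∈ Y.offDiag, ∀ᵐ w : ι → ℝ, w ⬝ᵥ (p.1 - p.2) ≠ 0 := fun p hp => by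
    let hyperplane := LinearMap.ker ((dotProductBilin ℝ ℝ).flip (p.1 - p.2))
    have hproper : hyperplane ≠ ⊤ := fun htop => hp.2.2 <| sub_eq_zero.1 <|
      dotProduct_self_eq_zero.1 (htop ▸ Submodule.mem_top : p.1 - p.2 ∈ hyperplane)
    exact measure_eq_zero_iff_ae_notMem.1 (Measure.addHaar_submodule volume _ hproper)
  obtain ⟨w, hw⟩ := ((ae_ball_iff hoffDiag).2 hpair).exists
  refine ⟨w, fun y hy y' hy' heq => ?_⟩
  by_contra hne
  exact hw (y, y') ⟨hy, hy', hne⟩ (by rw [dotProduct_sub]; exact sub_eq_zero.2 heq)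

theorem exists_injOn_abs_add {Y : Set ℝ} (hY : Y.Countable) :
    ∃ b : ℝ, Set.InjOn (fun y => |y + b|) Y ∧ ∀ y ∈ Y, 0 < |y + b| := by
  obtain ⟨b, hb⟩ := (((hY.prod hY).image fun p => -(p.1 + p.2) / 2).dense_compl ℝ).nonempty
  have hne : ∀ y ∈ Y, ∀ y' ∈ Y, y + b ≠ -(y' + b) := fun y hy y' hy' h =>
    hb ⟨(y, y'), ⟨hy, hy'⟩, show -(y + y') / 2 = b by linarith⟩
  refine ⟨b, fun y hy y' hy' h => ?_, fun y hy => abs_pos.2 fun h => ?_⟩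
  · exact add_right_cancel ((abs_eq_abs.1 h).resolve_right (hne y hy y' hy'))
  · exact hne y hy y hy (by rw [h, neg_zero])

end GenericParameters

section Perceptrons

variable {m n : ℕ}

/-- A perceptron computing the linear map `A`, as `A x = relu (A x) - relu (-A x)`. -/
def linearMLP (A : Matrix (Fin n) (Fin m) ℝ) : MLP m n :=
  .shallow (k := n + n) (Matrix.of (Fin.append A.row (-A).row)) 0
    (Matrix.of fun j => Fin.append (Pi.single j 1) (Pi.single j (-1))) 0

theorem linearMLP_eval (A : Matrix (Fin n) (Fin m) ℝ) (x : Fin m → ℝ) :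
    (linearMLP A).eval x = A.mulVec x := by
  funext j
  simp only [linearMLP, MLP.eval, affine, relu, add_zero, Matrix.mulVec, dotProduct,
    Matrix.of_apply, Fin.sum_univ_add, Fin.append_left, Fin.append_right, Pi.single_apply,
    ite_mul, one_mul, neg_mul, zero_mul, Finset.sum_ite_eq', Finset.mem_univ, if_true,
    Matrix.row_apply, Matrix.neg_apply, Finset.sum_neg_distrib, ← sub_eq_add_neg]
  exact max_zero_sub_max_neg_zero_eq_self _

/-- A perceptron computing `x ↦ |w ⬝ᵥ x + b|`, as `|r| = relu r + relu (-r)`. -/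
def absMLP (w : Fin m → ℝ) (b : ℝ) : MLP m 1 :=
  .shallow (k := 2) (Matrix.of ![w, -w]) ![b, -b] (Matrix.of ![![1, 1]]) 0

theorem absMLP_eval (w : Fin m → ℝ) (b : ℝ) (x : Fin m → ℝ) :
    (absMLP w b).eval x = ![|w ⬝ᵥ x + b|] := by
  have hrelu : relu (affine (Matrix.of ![w, -w]) ![b, -b] x) =
      ![max (w ⬝ᵥ x + b) 0, max (-(w ⬝ᵥ x + b)) 0] := by
    funext i
    fin_cases i <;> simp [relu, affine, add_comm]
  rw [absMLP, MLP.eval, hrelu]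
  funext i
  rw [Subsingleton.elim i 0]
  simpa [affine, Matrix.mulVec] using max_zero_add_max_neg_zero_eq_abs_self (w ⬝ᵥ x + b)

open Classical in
theorem ginLayer_linearMLP_neg_one {V : Type v} [Fintype V] (ε : ℝ) (g : SimpleGraph V)
    (h : V → Fin m → ℝ) (x : V) (i : Fin m) :
    ginLayer ε (linearMLP (-1)) g h x i =
      -((1 + ε) • h x i + ∑ y ∈ g.neighborFinset x, h y i) := by
  rw [ginLayer, linearMLP_eval, Matrix.neg_mulVec, Matrix.one_mulVec, Pi.neg_apply, Pi.add_apply,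
    Pi.smul_apply, Finset.sum_apply]

end Perceptrons

section LGVR

variable {N : ℕ} {V : Type v} [Fintype V]

open Classical in
/-- The weights of the pairs of nodes in the filtration of the LGVR diagram. -/
def lgvrWeight (θ : LGVRWeights N) (g : SimpleGraph V) (c : V → Feature N) (e : Sym2 V) : EReal :=
  if he : e ∈ (⊤ : SimpleGraph V).edgeSet then (edgeValue θ g c ⟨e, he⟩ : EReal) else 0

theorem lgvrWeight_of_not_isDiag (θ : LGVRWeights N) (g : SimpleGraph V) (c : V → Feature N)
    {e : Sym2 V} (he : ¬ e.IsDiag) :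
    lgvrWeight θ g c e = (edgeValue θ g c ⟨e, by simpa using he⟩ : EReal) :=
  dif_pos _

theorem LGVR_eq_ripsDiagrams (θ : LGVRWeights N) (g : SimpleGraph V) (c : V → Feature N) :
    LGVR θ g c =
      ripsDiagrams (fun t : Set.Icc (0 : ℝ) (1 / 2) => (t : ℝ)) (lgvrWeight θ g c) := by
  have hmatrix : (fun x y => (edgeMatrix θ g c x y : EReal)) = weightMatrix (lgvrWeight θ g c) := by
    funext x y
    rw [edgeMatrix, weightMatrix]
    split_ifs with hxy
    · rfl
    · exact (lgvrWeight_of_not_isDiag θ g c (e := s(x, y)) hxy).symm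
  rw [LGVR, hmatrix]
  rfl

end LGVR

section ShallowNets

variable {N : ℕ}

/-- The edge coloring `φ` for the map `x ↦ x'` all of whose coordinates are `w₀ ⬝ᵥ x`. -/
def colorCode (w₀ : Fin N → ℝ) : Sym2 (Feature N) → Fin (N + N) → ℝ :=
  Sym2.lift ⟨fun x y => Fin.append (fun _ => w₀ ⬝ᵥ x + w₀ ⬝ᵥ y) fun _ => |w₀ ⬝ᵥ x - w₀ ⬝ᵥ y|,
    fun x y => by simp only [add_comm, abs_sub_comm]⟩

theorem map_mem_sym2 {α β : Type*} {c : α → β} {s : Set β} (hc : ∀ x, c x ∈ s) (e : Sym2 α) :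
    e.map c ∈ s.sym2 := by
  induction e with | _ x y
  exact ⟨hc x, hc y⟩

theorem eq_or_swap_of_add_eq_of_abs_sub_eq {a b c d : ℝ} (hadd : a + b = c + d)
    (habs : |a - b| = |c - d|) : a = c ∧ b = d ∨ a = d ∧ b = c := by
  rcases abs_eq_abs.1 habs with hsub | hsub
  · exact .inl ⟨by linarith, by linarith⟩
  · exact .inr ⟨by linarith, by linarith⟩

theorem injOn_colorCode {w₀ : Fin N → ℝ} {χ : Set (Feature N)} (hw₀ : Set.InjOn (w₀ ⬝ᵥ ·) χ) :
    Set.InjOn (colorCode w₀) χ.sym2 := by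
  rcases Nat.eq_zero_or_pos N with rfl | hN
  · exact fun e _ f _ _ => Subsingleton.elim e f
  intro e he f hf heq
  induction e with | _ x y
  induction f with | _ x' y'
  obtain ⟨hx, hy⟩ := Set.mk_mem_sym2_iff.1 he
  obtain ⟨hx', hy'⟩ := Set.mk_mem_sym2_iff.1 hf
  have hadd := congrFun heq (Fin.castAdd N ⟨0, hN⟩)
  have habs := congrFun heq (Fin.natAdd N ⟨0, hN⟩)
  simp only [colorCode, Sym2.lift_mk, Fin.append_left, Fin.append_right] at hadd habs
  rcases eq_or_swap_of_add_eq_of_abs_sub_eq hadd habs with ⟨h₁, h₂⟩ | ⟨h₁, h₂⟩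
  · rw [hw₀ hx hx' h₁, hw₀ hy hy' h₂]
  · rw [hw₀ hx hy' h₁, hw₀ hy hx' h₂, Sym2.eq_swap]

/-- The parameters of an LGVR network whose two graph isomorphism networks have a single layer and
scalar output: all coordinates of `x'` are `w₀ ⬝ᵥ x`, the perceptron of `P₁` is
`y ↦ |w ⬝ᵥ y + b|`, and the one of `P₂` is the negation. -/
structure ShallowNet (N : ℕ) where
  w₀ : Fin N → ℝ
  ε₁ : ℝ
  w : Fin (N + N) → ℝ
  b : ℝ
  ε₂ : ℝ

namespace ShallowNet

variable (net : ShallowNet N)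

/-- The network with these parameters. Taking `m x = (w₀ ⬝ᵥ x, …, w₀ ⬝ᵥ x) - x` and `η = 1` gives
`x' = (w₀ ⬝ᵥ x, …, w₀ ⬝ᵥ x)`. -/
def toWeights : LGVRWeights N where
  mlp := linearMLP (Matrix.of (fun _ => net.w₀) - 1)
  η := 1
  d := 1
  P₁ := .last net.ε₁ (absMLP net.w net.b)
  P₂ := .last net.ε₂ (linearMLP (-1))

theorem phi_toWeights : phi net.toWeights = colorCode net.w₀ := by
  have hshifted : ∀ x, shifted net.toWeights x = fun _ => net.w₀ ⬝ᵥ x := fun x => by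
    simp only [shifted, toWeights, linearMLP_eval, one_smul, Matrix.sub_mulVec, Matrix.one_mulVec,
      add_sub_cancel]
    rfl
  funext e
  induction e with | _ x y
  simp only [phi, colorCode, Sym2.lift_mk, hshifted]
  rfl

/-- The perceptron of `P₁`. -/
def response (y : Fin (N + N) → ℝ) : ℝ := |net.w ⬝ᵥ y + net.b|

section Values

variable {V : Type v} [Fintype V] (g : SimpleGraph V) (c : V → Feature N)

/-- The feature of a pair of nodes to which `P₂` is applied. -/
def pairFeature (e : (⊤ : SimpleGraph V).edgeSet) : ℝ :=
  extendedFeatures net.toWeights g c e (0 : Fin 1)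

open Classical in
/-- The argument of the perceptron of `P₁` at an edge. -/
def edgeInput (e : g.edgeSet) : Fin (N + N) → ℝ :=
  (1 + net.ε₁) • colorCode net.w₀ ((e : Sym2 V).map c) +
    ∑ f ∈ g.lineGraph.neighborFinset e, colorCode net.w₀ ((f : Sym2 V).map c)

theorem pairFeature_of_mem {e : (⊤ : SimpleGraph V).edgeSet} (he : (e : Sym2 V) ∈ g.edgeSet) :
    net.pairFeature g c e = net.response (net.edgeInput g c ⟨e, he⟩) := by
  rw [pairFeature, extendedFeatures, dif_pos he, edgeInput, ← phi_toWeights]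
  exact congrFun (absMLP_eval net.w net.b _) 0

theorem pairFeature_of_notMem {e : (⊤ : SimpleGraph V).edgeSet} (he : (e : Sym2 V) ∉ g.edgeSet) :
    net.pairFeature g c e = 0 := by
  rw [pairFeature, extendedFeatures, dif_neg he]
  rfl

theorem pairFeature_nonneg (e : (⊤ : SimpleGraph V).edgeSet) : 0 ≤ net.pairFeature g c e := by
  by_cases he : (e : Sym2 V) ∈ g.edgeSet
  · rw [pairFeature_of_mem net g c he]
    exact abs_nonneg _
  · rw [pairFeature_of_notMem net g c he]

open Classical in
/-- The argument of the perceptron of `P₂`. -/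
def pairInput (e : (⊤ : SimpleGraph V).edgeSet) : ℝ :=
  (1 + net.ε₂) • net.pairFeature g c e +
    ∑ f ∈ (⊤ : SimpleGraph V).lineGraph.neighborFinset e, net.pairFeature g c f

open Classical in
theorem edgeValue_toWeights (e : (⊤ : SimpleGraph V).edgeSet) :
    edgeValue net.toWeights g c e = Real.sigmoid (-net.pairInput g c e) :=
  congrArg Real.sigmoid (ginLayer_linearMLP_neg_one _ _ _ e (0 : Fin 1))

variable {net g c}

theorem edgeValue_le_half (hε₂ : 0 ≤ 1 + net.ε₂) (e : (⊤ : SimpleGraph V).edgeSet) :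
    edgeValue net.toWeights g c e ≤ 1 / 2 := by
  have hnonneg : 0 ≤ net.pairInput g c e :=
    add_nonneg (smul_nonneg hε₂ (net.pairFeature_nonneg g c e))
      (Finset.sum_nonneg fun f _ => net.pairFeature_nonneg g c f)
  rwa [edgeValue_toWeights, one_div, ← Real.sigmoid_zero, Real.sigmoid_le_iff,
    Left.neg_nonpos_iff]

end Values

/-- The codes of the pairs of colors in `χ`. -/
def codes (χ : Set (Feature N)) : Set (Fin (N + N) → ℝ) := colorCode net.w₀ '' χ.sym2

theorem colorCode_mem_codes {V : Type*} {c : V → Feature N} {χ : Set (Feature N)}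
    (hc : ∀ x, c x ∈ χ) (e : Sym2 V) : colorCode net.w₀ (e.map c) ∈ net.codes χ :=
  Set.mem_image_of_mem _ (map_mem_sym2 hc e)

theorem edgeInput_mem {V : Type v} [Fintype V] {g : SimpleGraph V} {c : V → Feature N}
    {χ : Set (Feature N)} (hc : ∀ x, c x ∈ χ) (e : g.edgeSet) :
    net.edgeInput g c e ∈ ginInputs net.ε₁ (net.codes χ) :=
  smul_add_sum_mem_ginInputs (net.colorCode_mem_codes hc e) fun f _ => net.colorCode_mem_codes hc f

theorem pairFeature_mem {V : Type v} [Fintype V] {g : SimpleGraph V} {c : V → Feature N}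
    {χ : Set (Feature N)} (hc : ∀ x, c x ∈ χ) (e : (⊤ : SimpleGraph V).edgeSet) :
    net.pairFeature g c e ∈ insert 0 (net.response '' ginInputs net.ε₁ (net.codes χ)) := by
  by_cases he : (e : Sym2 V) ∈ g.edgeSet
  · exact .inr ⟨_, net.edgeInput_mem hc _, (net.pairFeature_of_mem g c he).symm⟩
  · exact .inl (net.pairFeature_of_notMem g c he)

/-- The network loses no information on nodes with features in `χ`: all its layers are injective on
the values that they may get, and `P₁` maps no edge to the feature `0` of the nonadjacent pairs. -/
structure IsGeneric (χ : Set (Feature N)) : Prop where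
  injOn_colorCode : Set.InjOn (colorCode net.w₀) χ.sym2
  separatesCenters₁ : SeparatesCenters net.ε₁ (net.codes χ)
  injOn_response : Set.InjOn net.response (ginInputs net.ε₁ (net.codes χ))
  response_pos : ∀ y ∈ ginInputs net.ε₁ (net.codes χ), 0 < net.response y
  one_lt_ε₂ : 1 < net.ε₂
  separatesCenters₂ : SeparatesCenters net.ε₂
    (insert 0 (net.response '' ginInputs net.ε₁ (net.codes χ)))

theorem exists_isGeneric {χ : Set (Feature N)} (hχ : χ.Countable) :
    ∃ net : ShallowNet N, net.IsGeneric χ := by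
  obtain ⟨w₀, hw₀⟩ := exists_injOn_dotProduct hχ
  have hcodes : (colorCode w₀ '' χ.sym2).Countable := (countable_sym2 hχ).image _
  obtain ⟨ε₁, -, hε₁⟩ := exists_separatesCenters hcodes
  have hinputs := countable_ginInputs ε₁ hcodes
  obtain ⟨w, hw⟩ := exists_injOn_dotProduct hinputs
  obtain ⟨b, hb, hpos⟩ := exists_injOn_abs_add (hinputs.image (w ⬝ᵥ ·))
  obtain ⟨ε₂, hε₂, hsep⟩ := exists_separatesCenters
    ((hinputs.image fun y => |w ⬝ᵥ y + b|).insert 0)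
  exact ⟨⟨w₀, ε₁, w, b, ε₂⟩, injOn_colorCode hw₀, hε₁, hb.comp hw (Set.mapsTo_image _ _),
    fun y hy => hpos _ ⟨y, hy, rfl⟩, hε₂, hsep⟩

namespace IsGeneric

variable {net} {χ : Set (Feature N)} {V W : Type v} [Fintype V] [Fintype W] {g : SimpleGraph V}
  {c : V → Feature N} {h : SimpleGraph W} {c' : W → Feature N}

theorem pairFeature_pos (hnet : net.IsGeneric χ) (hc : ∀ x, c x ∈ χ)
    {e : (⊤ : SimpleGraph V).edgeSet} (he : (e : Sym2 V) ∈ g.edgeSet) :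
    0 < net.pairFeature g c e := by
  rw [pairFeature_of_mem net g c he]
  exact hnet.response_pos _ (net.edgeInput_mem hc _)

theorem pairFeature_eq_of_edgeValue_eq (hnet : net.IsGeneric χ) (hc : ∀ x, c x ∈ χ)
    (hc' : ∀ x, c' x ∈ χ) {e : (⊤ : SimpleGraph V).edgeSet} {e' : (⊤ : SimpleGraph W).edgeSet}
    (heq : edgeValue net.toWeights g c e = edgeValue net.toWeights h c' e') :
    net.pairFeature g c e = net.pairFeature h c' e' := by
  rw [edgeValue_toWeights, edgeValue_toWeights, Real.sigmoid_inj, neg_inj] at heq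
  exact hnet.separatesCenters₂.eq (net.pairFeature_mem hc e) (net.pairFeature_mem hc' e')
    (fun f _ => net.pairFeature_mem hc f) (fun f _ => net.pairFeature_mem hc' f) heq

theorem pairColor_eq_of_pairFeature_eq (hnet : net.IsGeneric χ) (hc : ∀ x, c x ∈ χ)
    (hc' : ∀ x, c' x ∈ χ) {e : (⊤ : SimpleGraph V).edgeSet} {e' : (⊤ : SimpleGraph W).edgeSet}
    (heq : net.pairFeature g c e = net.pairFeature h c' e') :
    pairColor g c e = pairColor h c' e' := by
  classical
  by_cases he : (e : Sym2 V) ∈ g.edgeSet <;> by_cases he' : (e' : Sym2 W) ∈ h.edgeSet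
  · rw [pairFeature_of_mem net g c he, pairFeature_of_mem net h c' he'] at heq
    have hinput := hnet.injOn_response (net.edgeInput_mem hc _) (net.edgeInput_mem hc' _) heq
    have hcode := hnet.separatesCenters₁.eq (net.colorCode_mem_codes hc e)
      (net.colorCode_mem_codes hc' e') (fun (f : g.edgeSet) _ => net.colorCode_mem_codes hc f)
      (fun (f : h.edgeSet) _ => net.colorCode_mem_codes hc' f) hinput
    rw [pairColor_of_mem he, pairColor_of_mem he']
    exact congrArg some (hnet.injOn_colorCode (map_mem_sym2 hc e) (map_mem_sym2 hc' e') hcode)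
  · rw [pairFeature_of_notMem net h c' he'] at heq
    exact absurd heq (hnet.pairFeature_pos hc he).ne'
  · rw [pairFeature_of_notMem net g c he] at heq
    exact absurd heq (hnet.pairFeature_pos hc' he').ne
  · rw [pairColor_of_notMem he, pairColor_of_notMem he']

end IsGeneric

end ShallowNet

end ShallowNets

section MeetingEdges

variable {V : Type v} [Fintype V] {g : SimpleGraph V} {d : ℕ}

open Classical in
/-- The edges of a graph that are different from a given pair of nodes but meet it. -/
def meetingEdges (g : SimpleGraph V) (e : Sym2 V) : Finset (Sym2 V) :=
  {f ∈ g.edgeFinset | e ≠ f ∧ ((e : Set V) ∩ (f : Set V)).Nonempty}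

open Classical in
theorem meetingEdges_mk (x y : V) : meetingEdges g s(x, y) =
    (g.incidenceFinset x ∪ g.incidenceFinset y).erase s(x, y) := by
  ext f
  simp only [meetingEdges, Finset.mem_filter, SimpleGraph.mem_edgeFinset, Finset.mem_erase,
    Finset.mem_union, SimpleGraph.mem_incidenceFinset, SimpleGraph.incidenceSet,
    Set.Nonempty, Set.mem_inter_iff, SetLike.mem_coe, Sym2.mem_iff, Set.mem_ofPred_eq]
  constructor
  · rintro ⟨hf, hne, z, rfl | rfl, hz⟩
    exacts [⟨hne.symm, .inl ⟨hf, hz⟩⟩, ⟨hne.symm, .inr ⟨hf, hz⟩⟩]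
  · rintro ⟨hne, ⟨hf, hz⟩ | ⟨hf, hz⟩⟩
    exacts [⟨hf, hne.symm, x, .inl rfl, hz⟩, ⟨hf, hne.symm, y, .inr rfl, hz⟩]

open Classical in
theorem card_meetingEdges_add_two (hg : g.IsRegularOfDegree d) {e : Sym2 V}
    (he : e ∈ g.edgeSet) : (meetingEdges g e).card + 2 = 2 * d := by
  induction e with | _ x y
  have hinter : g.incidenceFinset x ∩ g.incidenceFinset y = {s(x, y)} := by
    rw [← Finset.coe_inj]
    simpa only [Finset.coe_inter, SimpleGraph.coe_incidenceFinset, Finset.coe_singleton] using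
      g.incidenceSet_inter_incidenceSet_of_adj he
  have hunion := Finset.card_union_add_card_inter (g.incidenceFinset x) (g.incidenceFinset y)
  rw [hinter, Finset.card_singleton, SimpleGraph.card_incidenceFinset_eq_degree,
    SimpleGraph.card_incidenceFinset_eq_degree, hg x, hg y] at hunion
  have hmem : s(x, y) ∈ g.incidenceFinset x ∪ g.incidenceFinset y :=
    Finset.mem_union_left _ ((g.mem_incidenceFinset x _).2 ⟨he, Sym2.mem_mk_left x y⟩)
  rw [meetingEdges_mk]
  have herase := Finset.card_erase_add_one hmem
  omega

open Classical in
theorem card_meetingEdges_le (hg : g.IsRegularOfDegree d) (e : Sym2 V) :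
    (meetingEdges g e).card ≤ 2 * d := by
  induction e with | _ x y
  rw [meetingEdges_mk]
  refine Finset.card_erase_le.trans ((Finset.card_union_le _ _).trans_eq ?_)
  rw [SimpleGraph.card_incidenceFinset_eq_degree, SimpleGraph.card_incidenceFinset_eq_degree,
    hg x, hg y, two_mul]

open Classical in
theorem sum_lineGraph_neighborFinset {M : Type*} [AddCommMonoid M] {h : SimpleGraph V}
    (hgh : g ≤ h) (e : h.edgeSet) [Fintype (h.lineGraph.neighborSet e)] (a : M) :
    ∑ f ∈ h.lineGraph.neighborFinset e, (if (f : Sym2 V) ∈ g.edgeSet then a else 0) =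
      (meetingEdges g e).card • a := by
  rw [← Finset.sum_filter, Finset.sum_const]
  congr 1
  refine Finset.card_bij (fun f _ => (f : Sym2 V)) ?_ (fun _ _ _ _ => Subtype.ext) ?_
  · intro f hf
    rw [Finset.mem_filter, SimpleGraph.mem_neighborFinset,
      SimpleGraph.lineGraph_adj_iff_exists] at hf
    obtain ⟨⟨hne, z, hz⟩, hfg⟩ := hf
    rw [meetingEdges, Finset.mem_filter, SimpleGraph.mem_edgeFinset]
    exact ⟨hfg, fun heq => hne (Subtype.ext heq), z, hz⟩
  · intro f hf
    rw [meetingEdges, Finset.mem_filter, SimpleGraph.mem_edgeFinset] at hf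
    obtain ⟨hfg, hne, z, hz⟩ := hf
    refine ⟨⟨f, SimpleGraph.edgeSet_mono hgh hfg⟩, ?_, rfl⟩
    rw [Finset.mem_filter, SimpleGraph.mem_neighborFinset, SimpleGraph.lineGraph_adj_iff_exists]
    exact ⟨⟨fun heq => hne (congrArg Subtype.val heq), z, hz⟩, hfg⟩

end MeetingEdges

namespace ShallowNet

section RegularGraphs

variable {N : ℕ} {net : ShallowNet N} {V : Type v} [Fintype V] {g : SimpleGraph V}
  {c : V → Feature N} {k : Feature N} {d : ℕ}

variable (net k d) in
/-- The feature of an edge in a `d`-regular graph all of whose nodes have color `k`. -/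
def regularFeature : ℝ := net.response ((net.ε₁ + 2 * d - 1) • colorCode net.w₀ s(k, k))

open Classical in
theorem pairFeature_of_isRegularOfDegree (hc : ∀ x, c x = k) (hg : g.IsRegularOfDegree d)
    (e : (⊤ : SimpleGraph V).edgeSet) :
    net.pairFeature g c e = if (e : Sym2 V) ∈ g.edgeSet then net.regularFeature k d else 0 := by
  split_ifs with he
  · have hcard : ((meetingEdges g e).card : ℝ) + 2 = 2 * d := by
      exact_mod_cast card_meetingEdges_add_two hg he
    have hsum := sum_lineGraph_neighborFinset (g := g) le_rfl ⟨e, he⟩ (colorCode net.w₀ s(k, k))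
    simp only [Subtype.coe_prop, if_true] at hsum
    rw [pairFeature_of_mem net g c he, regularFeature, edgeInput]
    simp only [map_const_eq hc]
    rw [hsum, ← Nat.cast_smul_eq_nsmul ℝ, ← add_smul]
    congr 2
    linarith
  · exact pairFeature_of_notMem net g c he

open Classical in
theorem pairInput_of_isRegularOfDegree (hc : ∀ x, c x = k) (hg : g.IsRegularOfDegree d)
    (e : (⊤ : SimpleGraph V).edgeSet) :
    net.pairInput g c e = ((if (e : Sym2 V) ∈ g.edgeSet then 1 + net.ε₂ else 0) +
      (meetingEdges g e).card) * net.regularFeature k d := by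
  simp only [pairInput, pairFeature_of_isRegularOfDegree hc hg, sum_lineGraph_neighborFinset le_top,
    nsmul_eq_mul, smul_eq_mul, mul_ite, mul_zero, add_mul, ite_mul, zero_mul]

variable (net k d) in
/-- The value of an edge in a `d`-regular graph all of whose nodes have color `k`. -/
def regularValue : ℝ := Real.sigmoid (-((net.ε₂ + 2 * d - 1) * net.regularFeature k d))

open Classical in
theorem edgeValue_le_regularValue_iff (hε₂ : 1 < net.ε₂) (hpos : 0 < net.regularFeature k d)
    (hc : ∀ x, c x = k) (hg : g.IsRegularOfDegree d) (e : (⊤ : SimpleGraph V).edgeSet) :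
    edgeValue net.toWeights g c e ≤ net.regularValue k d ↔ (e : Sym2 V) ∈ g.edgeSet := by
  rw [edgeValue_toWeights, regularValue, Real.sigmoid_le_iff, neg_le_neg_iff,
    pairInput_of_isRegularOfDegree hc hg, mul_le_mul_iff_left₀ hpos]
  split_ifs with he
  · have hcard : ((meetingEdges g e).card : ℝ) + 2 = 2 * d := by
      exact_mod_cast card_meetingEdges_add_two hg he
    exact iff_of_true (by linarith) he
  · have hcard : ((meetingEdges g e).card : ℝ) ≤ 2 * d := by
      exact_mod_cast card_meetingEdges_le hg (e : Sym2 V)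
    exact iff_of_false (by linarith) he

end RegularGraphs

namespace IsGeneric

variable {N : ℕ} {net : ShallowNet N} {χ : Set (Feature N)} {k : Feature N} {d : ℕ}

theorem regularFeature_pos (hnet : net.IsGeneric χ) (hk : k ∈ χ) (hd : 0 < d) :
    0 < net.regularFeature k d := by
  obtain ⟨m, rfl⟩ := Nat.exists_eq_add_one.2 hd
  have hcode : colorCode net.w₀ s(k, k) ∈ net.codes χ :=
    Set.mem_image_of_mem _ (Set.mk_mem_sym2_iff.2 ⟨hk, hk⟩)
  have hinput := smul_add_sum_mem_ginInputs (ε := net.ε₁) hcode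
    (t := Finset.range (2 * m)) (f := fun _ => colorCode net.w₀ s(k, k)) fun _ _ => hcode
  rw [Finset.sum_const, Finset.card_range, ← Nat.cast_smul_eq_nsmul ℝ, ← add_smul] at hinput
  have hcoeff : net.ε₁ + 2 * ((m + 1 : ℕ) : ℝ) - 1 = 1 + net.ε₁ + (2 * m : ℕ) := by
    push_cast
    ring
  rw [regularFeature, hcoeff]
  exact hnet.response_pos _ hinput

theorem regularValue_mem_Icc (hnet : net.IsGeneric χ) (hk : k ∈ χ) (hd : 0 < d) :
    net.regularValue k d ∈ Set.Icc (0 : ℝ) (1 / 2) := by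
  refine ⟨Real.sigmoid_nonneg _, ?_⟩
  have hd' : (1 : ℝ) ≤ d := by exact_mod_cast hd
  have hε₂ := hnet.one_lt_ε₂
  rw [regularValue, one_div, ← Real.sigmoid_zero, Real.sigmoid_le_iff, Left.neg_nonpos_iff]
  exact mul_nonneg (by linarith) (hnet.regularFeature_pos hk hd).le

theorem isColorFiltration {𝒢 : GraphSpace.{u, v}} {C : NodeColoring 𝒢 N}
    (hnet : net.IsGeneric χ) (hC : ∀ G x, C G x ∈ χ) :
    IsColorFiltration C (fun t : Set.Icc (0 : ℝ) (1 / 2) => (t : ℝ))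
      fun G => lgvrWeight net.toWeights (𝒢.graph G) (C G) where
  isTimed G e he := by
    rw [lgvrWeight_of_not_isDiag _ _ _ he]
    have hε₂ := hnet.one_lt_ε₂
    exact .inr ⟨⟨_, Real.sigmoid_nonneg _, edgeValue_le_half (by linarith) _⟩,
      Real.sigmoid_pos _, rfl⟩
  pairColor_eq {G H e e'} he he' heq := by
    rw [lgvrWeight_of_not_isDiag _ _ _ he, lgvrWeight_of_not_isDiag _ _ _ he'] at heq
    exact hnet.pairColor_eq_of_pairFeature_eq (hC G) (hC H)
      (hnet.pairFeature_eq_of_edgeValue_eq (hC G) (hC H) (EReal.coe_injective heq))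
  exists_edgeGraph_eq {k d} hk hd := by
    have hkχ : k ∈ χ := by
      obtain ⟨G, x, y, -, hxy⟩ := hk
      rcases Sym2.eq_iff.1 hxy with ⟨rfl, -⟩ | ⟨rfl, -⟩ <;> exact hC G _
    obtain ⟨t, ht⟩ : ∃ t : Set.Icc (0 : ℝ) (1 / 2), (t : ℝ) = net.regularValue k d :=
      ⟨⟨_, hnet.regularValue_mem_Icc hkχ hd⟩, rfl⟩
    refine ⟨t, fun G hCG hG => ?_⟩
    rw [← SimpleGraph.edgeSet_inj, ripsFiltration_edgeSet t.2.1]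
    ext e
    rw [Set.mem_ofPred_eq]
    by_cases he : e.IsDiag
    · exact iff_of_false (fun h => h.1 he) fun h => (𝒢.graph G).not_isDiag_of_mem_edgeSet h he
    · rw [lgvrWeight_of_not_isDiag _ _ _ he, ht, EReal.coe_le_coe_iff, edgeValue_le_regularValue_iff
        hnet.one_lt_ε₂ (hnet.regularFeature_pos hkχ hd) hCG hG, and_iff_right he]

end IsGeneric

end ShallowNet

/-- The disjoint union of two triangles. -/
def twoTriangles : SimpleGraph (Fin 6) where
  Adj i j := i ≠ j ∧ (i < 3 ↔ j < 3)
  symm := ⟨fun _ _ h => ⟨h.1.symm, h.2.symm⟩⟩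
  loopless := ⟨fun _ h => h.1 rfl⟩

instance : DecidableRel twoTriangles.Adj := fun i j =>
  inferInstanceAs (Decidable (i ≠ j ∧ (i < 3 ↔ j < 3)))

theorem not_preconnected_twoTriangles : ¬ twoTriangles.Preconnected := by
  intro h
  obtain ⟨p⟩ := h 0 3
  have hside : ∀ {i j}, twoTriangles.Walk i j → (i < 3 ↔ j < 3) := fun {i j} p => by
    induction p with
    | nil => rfl
    | cons hadj _ ih => exact hadj.2.trans ih
  exact absurd (hside p) (by decide)

theorem card_connectedComponent_cycleGraph_ne_twoTriangles :
    Nat.card (SimpleGraph.cycleGraph 6).ConnectedComponent ≠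
      Nat.card twoTriangles.ConnectedComponent := by
  have hcycle : (SimpleGraph.cycleGraph 6).Connected := SimpleGraph.cycleGraph_connected
  have := hcycle.preconnected.subsingleton_connectedComponent
  rw [Nat.card_of_subsingleton ((SimpleGraph.cycleGraph 6).connectedComponentMk 0)]
  intro hcard
  have := (Nat.card_eq_one_iff_unique.1 hcard.symm).1
  exact not_preconnected_twoTriangles fun i j =>
    SimpleGraph.ConnectedComponent.exact (Subsingleton.elim _ _)

open Classical in
theorem isRegularOfDegree_of_iso {V W : Type*} [Fintype V] [Fintype W] {g : SimpleGraph V}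
    {h : SimpleGraph W} {d : ℕ} (φ : g ≃g h) (hg : g.IsRegularOfDegree d) :
    h.IsRegularOfDegree d :=
  fun x => (φ.symm.degree_eq x).symm.trans (hg _)

open Classical in
theorem ContainsAllFiniteGraphs.exists_isRegularOfDegree_two {𝒢 : GraphSpace.{u, v}}
    (h𝒢 : ContainsAllFiniteGraphs 𝒢) :
    ∃ G H : 𝒢.Idx, (𝒢.graph G).IsRegularOfDegree 2 ∧ (𝒢.graph H).IsRegularOfDegree 2 ∧
      Nonempty (𝒢.V G) ∧ Nat.card (𝒢.V G) = Nat.card (𝒢.V H) ∧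
      Nat.card (𝒢.graph G).ConnectedComponent ≠ Nat.card (𝒢.graph H).ConnectedComponent := by
  obtain ⟨G, ⟨φ⟩⟩ := h𝒢 6 (SimpleGraph.cycleGraph 6)
  obtain ⟨H, ⟨ψ⟩⟩ := h𝒢 6 twoTriangles
  refine ⟨G, H, isRegularOfDegree_of_iso φ fun i => ?_, isRegularOfDegree_of_iso ψ fun i => ?_,
    ⟨φ 0⟩, Nat.card_congr (φ.toEquiv.symm.trans ψ.toEquiv), ?_⟩
  · convert SimpleGraph.cycleGraph_degree_three_le (n := 3) (v := i)
  · have hdegree : ∀ j, twoTriangles.degree j = 2 := by decide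
    convert hdegree i
  · rw [← Nat.card_congr φ.connectedComponentEquiv, ← Nat.card_congr ψ.connectedComponentEquiv]
    exact card_connectedComponent_cycleGraph_ne_twoTriangles

open Classical in
/-- By the Weisfeiler-Lehman test, all nodes of all `2`-regular graphs have the same color. -/
theorem IsStableWL.exists_isRegularOfDegree_two {𝒢 : GraphSpace.{u, v}} {N : ℕ}
    {C : NodeColoring 𝒢 N} (hC : IsStableWL C) (h𝒢 : ContainsAllFiniteGraphs 𝒢) :
    ∃ (G H : 𝒢.Idx) (k : Feature N), s(k, k) ∈ coloredEdges C ∧ (∀ x, C G x = k) ∧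
      (∀ x, C H x = k) ∧ (𝒢.graph G).IsRegularOfDegree 2 ∧ (𝒢.graph H).IsRegularOfDegree 2 ∧
      Nat.card (𝒢.V G) = Nat.card (𝒢.V H) ∧
      Nat.card (𝒢.graph G).ConnectedComponent ≠ Nat.card (𝒢.graph H).ConnectedComponent := by
  obtain ⟨G, H, hG, hH, ⟨x⟩, hcard, hcomponents⟩ := h𝒢.exists_isRegularOfDegree_two
  have hCG : ∀ y, C G y = C G x := fun y =>
    (hC _ _ _ _).2 fun t => wlColor_eq_of_isRegularOfDegree hG hG t _ _
  have hCH : ∀ y, C H y = C G x := fun y =>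
    (hC _ _ _ _).2 fun t => wlColor_eq_of_isRegularOfDegree hH hG t _ _
  obtain ⟨y, hxy⟩ := ((𝒢.graph G).degree_pos_iff_exists_adj x).1 ((hG x).symm ▸ two_pos)
  exact ⟨G, H, C G x, ⟨G, x, y, hxy, by rw [hCG y]⟩, hCG, hCH, hG, hH, hcard, hcomponents⟩

end

end TopEdge

theorem theorem5p2 (N : ℕ) (χ : Set (TopEdge.Feature N)) (hχ : χ.Countable) :
    ∃ θ : TopEdge.LGVRWeights N,
      ∀ (𝒢 : TopEdge.GraphSpace.{u, v}) (C : TopEdge.NodeColoring 𝒢 N), (∀ G x, C G x ∈ χ) →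
        (TopEdge.DegreeAssumption C →
          ∀ G H : 𝒢.Idx, TopEdge.NoIsolated (𝒢.graph G) → TopEdge.NoIsolated (𝒢.graph H) →
            TopEdge.colorMultiset C G ≠ TopEdge.colorMultiset C H →
            TopEdge.LGVR θ (𝒢.graph G) (C G) ≠ TopEdge.LGVR θ (𝒢.graph H) (C H) ∧
            ∀ ef, TopEdge.IsInjectiveEdgeFiltration C ef →
              TopEdge.TED C ef G ≠ TopEdge.TED C ef H) ∧
        (TopEdge.IsStableWL C →
          (∀ G H : 𝒢.Idx, TopEdge.colorMultiset C G ≠ TopEdge.colorMultiset C H →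
            TopEdge.LGVR θ (𝒢.graph G) (C G) ≠ TopEdge.LGVR θ (𝒢.graph H) (C H) ∧
            ∀ ef, TopEdge.IsInjectiveEdgeFiltration C ef →
              TopEdge.TED C ef G ≠ TopEdge.TED C ef H) ∧
          (TopEdge.ContainsAllFiniteGraphs 𝒢 →
            ∃ G H : 𝒢.Idx, TopEdge.colorMultiset C G = TopEdge.colorMultiset C H ∧
              TopEdge.LGVR θ (𝒢.graph G) (C G) ≠ TopEdge.LGVR θ (𝒢.graph H) (C H) ∧
              ∀ ef, TopEdge.IsInjectiveEdgeFiltration C ef →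
                TopEdge.TED C ef G ≠ TopEdge.TED C ef H)) := by
  obtain ⟨net, hnet⟩ := TopEdge.ShallowNet.exists_isGeneric hχ
  refine ⟨net.toWeights, fun 𝒢 C hC => ?_⟩
  simp only [TopEdge.LGVR_eq_ripsDiagrams, TopEdge.TED_eq_ripsDiagrams]
  have hL := hnet.isColorFiltration hC
  have hT {ef} (hef : TopEdge.IsInjectiveEdgeFiltration C ef) := hef.isColorFiltration
  have hIcc := TopEdge.isTimeAxis_Icc (r := 1 / 2) (by norm_num)
  have hNNReal := TopEdge.isTimeAxis_nnreal
  refine ⟨fun hdeg G H hG hH hne => ⟨?_, fun ef hef => ?_⟩,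
    fun hWL => ⟨fun G H hne => ⟨?_, fun ef hef => ?_⟩, fun hall => ?_⟩⟩
  · exact hL.ripsDiagrams_ne_of_degreeAssumption hIcc hdeg hG hH hne
  · exact (hT hef).ripsDiagrams_ne_of_degreeAssumption hNNReal hdeg hG hH hne
  · exact hL.ripsDiagrams_ne_of_isStableWL hIcc hWL hne
  · exact (hT hef).ripsDiagrams_ne_of_isStableWL hNNReal hWL hne
  · obtain ⟨G, H, k, hk, hkG, hkH, hG, hH, hcard, hne⟩ := hWL.exists_isRegularOfDegree_two hall
    exact ⟨G, H, TopEdge.colorMultiset_eq_of_const hkG hkH hcard,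
      hL.ripsDiagrams_ne_of_isRegularOfDegree hIcc hk two_pos hkG hkH hG hH hne,
      fun ef hef => (hT hef).ripsDiagrams_ne_of_isRegularOfDegree hNNReal hk two_pos hkG hkH hG hH
        hne⟩
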